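/- An \emph{oriented rectangular diagram of a knot} is an oriented closed curve in $\mathbb R^2$ composed alternately of $n\ge 2$ vertical and $n$ horizontal segments (its \emph{edges}), no two of them collinear, the vertical edge passing over the horizontal one at each crossing. Diagrams are considered up to planar isotopies that keep the edges vertical or horizontal, i.e. up to changes of the abscissae and of the heights that preserve the left-to-right order of the vertical edges and the bottom-to-top order of the horizontal edges. Call two parallel edges \emph{adjacent} if no edge parallel to them lies strictly between their positions (abscissae for vertical edges, heights for horizontal ones), \emph{extreme} if all edges parallel to them lie between their positions, and \emph{interleaved} if the positions of their endpoints, along the direction of the edges, strictly alternate. An \emph{exchange move} interchanges the positions of two parallel edges that are adjacent (interior exchange) or extreme (exterior exchange) and that are not interleaved. A \emph{merge move} takes three successive edges $e,f,g$ such that the parallel edges $e,g$ are adjacent (interior merge) or extreme (exterior merge), and amalgamates them into a single edge, placed in the position of $e$ or in that of $g$; the result is required to be again a rectangular diagram. The moves carry the orientation along. An oriented rectangular diagram $R$ is an \emph{outline} of $\tilde R$ if $\tilde R$ is obtained from $R$ by replacing each edge $e$ by a notched edge: a long edge followed by $2r_e$ very short edges ($r_e\ge 0$ depending on $e$), alternately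 perpendicular and parallel to $e$, where, if $d$ is the edge of $R$ preceding $e$, the short edges perpendicular to $e$ go in the direction of $d$ and those parallel to $e$ go in the direction of $e$ (so that they go away from the right angle between $d$ and $e$). ``Very short'' means that shrinking all the short edges to points recovers $R$, edges of $\tilde R$ that become parallel edges at different positions of $R$ being in the same order as these. \textbf{Lemma.} Let $S_0\to S_1\to\cdots\to S_m$ be a sequence of oriented rectangular diagrams of a knot such that, for $1\le i\le m$, $S_i$ is obtained from $S_{i-1}$ by a merge or exchange move. Then there is a sequence $\tilde S_0,\tilde S_1,\dots,\tilde S_m$ of oriented rectangular diagrams with $\tilde S_0=S_0$ such that $S_i$ is an outline of $\tilde S_i$ for $0\le i\le m$ and $\tilde S_i$ is obtained from $\tilde S_{i-1}$ by a finite (possibly empty) sequence of exchange moves for $1\le i\le m$. -/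

import Mathlib

/-- A vertical or horizontal line of the plane: `pos` is the abscissa of a vertical line and the
height of a horizontal one. -/
@[ext]
structure Line where
  vert : Bool
  pos : ℝ

noncomputable instance instDecidableEqLine : DecidableEq Line := Classical.decEq Line

/-- An oriented rectangular diagram of a knot. It is a closed oriented curve made of segments (the
edges) lying alternately on vertical and horizontal lines, different edges lying on different lines.
An edge is therefore determined by the line containing it, and the curve by the cyclic sequence of
these lines in the order in which they are traversed: the edge on the line `a` runs from the line
visited just before `a` to the line visited just after it. At each crossing the vertical
edge is the over-strand, so that crossings carry no further data. There are at least two vertical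
and two horizontal edges. -/
structure RectDiagram where
  edges : Cycle Line
  nodup : edges.Nodup
  alternating : edges.Chain (fun a b => a.vert ≠ b.vert)
  four_le_length : 4 ≤ edges.length

namespace RectDiagram

/-- The lines of the list `w` are visited successively, in this order, in the cyclic sequence `s`. -/
def Successive (s : Cycle Line) (w : List Line) : Prop :=
  ∃ l : List Line, s = ((w ++ l : List Line) : Cycle Line)

/-- Two cyclic sequences of lines describe the same rectangular diagram up to a planar isotopy that
keeps the edges vertical or horizontal: they correspond by a relabelling of the lines that respects
the left-to-right order of the vertical lines and the bottom-to-top order of the horizontal ones. -/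
def SameUpToIsotopy (s t : Cycle Line) : Prop :=
  ∃ f : Line → Line,
    (∀ a ∈ s, (f a).vert = a.vert) ∧
    (∀ a ∈ s, ∀ b ∈ s, a.vert = b.vert → a.pos < b.pos → (f a).pos < (f b).pos) ∧
    s.map f = t

/-- No edge parallel to the parallel edges `a`, `b` lies strictly between them. -/
def NoneBetween (s : Cycle Line) (a b : Line) : Prop :=
  ∀ k ∈ s, k.vert = a.vert → k.pos ∉ Set.uIoo a.pos b.pos

/-- All edges parallel to the parallel edges `a`, `b` lie between them: `a` and `b` are the two
extreme edges (top and bottom, or leftmost and rightmost). -/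
def AllBetween (s : Cycle Line) (a b : Line) : Prop :=
  ∀ k ∈ s, k.vert = a.vert → k.pos ∈ Set.uIcc a.pos b.pos

/-- The two-point sets `{p, n}` and `{p', n'}` alternate on the real line. -/
def Alternate (p n p' n' : ℝ) : Prop :=
  (min p n < min p' n' ∧ min p' n' < max p n ∧ max p n < max p' n') ∨
  (min p' n' < min p n ∧ min p n < max p' n' ∧ max p' n' < max p n)

/-- The parallel edges `a`, `b` of `s` are interleaved: their endpoints (on the lines visited just
before and just after `a`, respectively `b`) alternate. -/
def Interleaved (s : Cycle Line) (a b : Line) : Prop :=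
  ∃ p n p' n' : Line, Successive s [p, a, n] ∧ Successive s [p', b, n'] ∧
    Alternate p.pos n.pos p'.pos n'.pos

/-- `T` is obtained from `S` by an (interior or exterior, horizontal or vertical) exchange move: two
parallel edges that are adjacent or extreme and that are not interleaved exchange their positions. -/
def Exchange (S T : RectDiagram) : Prop :=
  ∃ a ∈ S.edges, ∃ b ∈ S.edges, a ≠ b ∧ a.vert = b.vert ∧
    (NoneBetween S.edges a b ∨ AllBetween S.edges a b) ∧
    ¬ Interleaved S.edges a b ∧
    SameUpToIsotopy (S.edges.map (Equiv.swap a b)) T.edges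

/-- `T` is obtained from `S` by an (interior or exterior, horizontal or vertical) merge move: the
successive edges `e`, `f`, `g`, where the parallel edges `e` and `g` are adjacent or extreme, are
amalgamated into one edge, which is placed in the position of `e` or in that of `g`. -/
def Merge (S T : RectDiagram) : Prop :=
  ∃ (e f g : Line) (l : List Line), S.edges = ((e :: f :: g :: l : List Line) : Cycle Line) ∧
    (NoneBetween S.edges e g ∨ AllBetween S.edges e g) ∧
    (SameUpToIsotopy ((e :: l : List Line) : Cycle Line) T.edges ∨
      SameUpToIsotopy ((g :: l : List Line) : Cycle Line) T.edges)

/-- The move from the line `a` to its parallel `b` goes in the same direction as that from `u` to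
its parallel `v`. -/
def SameDirection (u v a b : Line) : Prop :=
  (u.pos < v.pos ∧ a.pos < b.pos) ∨ (v.pos < u.pos ∧ b.pos < a.pos)

/-- The edges of a notched edge in the order of traversal: the long edge followed by pairs of short
edges, one pair for each notch. -/
def notchedEdge (long : Line) (notches : List (Line × Line)) : List Line :=
  long :: notches.flatMap (fun z => [z.1, z.2])

/-- `S` is an outline of `T`: `T` is obtained from `S` by replacing each edge `e` by a notched
edge, which consists of the long edge `long e` followed by the short edges `z.1`, `z.2` for the
pairs `z` in the list `notches e`.

That the short edges are very short means that `T` becomes `S` when they are shrunk to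
points; `shrink` sends each edge of `T` to the line on which it then lies, and lines with
different images are ordered as their images are.

For successive edges `c`, `d`, `e`, `g` of `S`, the short edges of the notched edge for `e` go away
from the right angle between `d` and `e`: those parallel to `d` go in the direction of
`d` (which runs from `c` to `e`), so that the edges parallel to `e` follow each other in that
direction, and those parallel to `e` go in the direction of `e` (which runs from `d` to
`g`), so that the short edges parallel to `d`, and then the long edge for `g`, follow each other in
that direction. -/
def IsOutline (S T : RectDiagram) : Prop :=
  ∃ (shrink long : Line → Line) (notches : Line → List (Line × Line)),
    (∃ l : List Line, S.edges = (l : Cycle Line) ∧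
      T.edges = ((l.flatMap (fun e => notchedEdge (long e) (notches e)) : List Line) :
        Cycle Line)) ∧
    (∀ a ∈ T.edges, (shrink a).vert = a.vert) ∧
    (∀ a ∈ T.edges, ∀ b ∈ T.edges, a.vert = b.vert →
      (shrink a).pos < (shrink b).pos → a.pos < b.pos) ∧
    (∀ c d e g : Line, Successive S.edges [c, d, e, g] →
      shrink (long e) = e ∧
      (∀ z ∈ notches e, shrink z.1 = g ∧ shrink z.2 = e) ∧
      (long e :: (notches e).map Prod.snd).Pairwise (SameDirection c e) ∧
      ((notches e).map Prod.fst ++ [long g]).Pairwise (SameDirection d g))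

end RectDiagram

/-! Read backwards, a merge move inserts two edges `n₁`, `n₂` at a corner formed by successive edges
`x`, `y` of the merged diagram. The inserted edges are not tied to the place where the merge finds
them. If the ends of an edge are adjacent or extreme, no other edge is interleaved with it, so it
can be exchanged past all its parallels (`not_inter_of_short`, `reach_update`). In a merge this
applies to `n₁` or to `n₂`. Putting `n₁` next to `y` makes the ends of `n₂` adjacent, and
symmetrically. Hence exchange moves bring `n₁` next to `y` and `n₂` next to `x`, on sides of one's
choice (`Corner.exists_good`).

Such a small insertion is compatible with exchange moves of the diagram without it
(`Corner.lift_exchange`). The delicate case is the exchange of `x` with some `b`: `n₁` is first put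
on the side of `y` that does not make `x` and `b` interleaved, `n₂` is moved out of the way, and
after the exchange it is brought back. Therefore, if `S'` is obtained from `S` by a merge and `T` is
equivalent to `S'` under exchanges, then `S` is equivalent to `T` with a small insertion at some
corner (`Merge.exists_inserted`, `Inserted.lift`).

If moreover `R` is an outline of `T`, then on suitable sides the inserted edges just add one notch
to a notched edge, and `R` is still an outline (`IsOutline.exists_sides`). Starting with `S i` as an
outline of itself and going back through the moves to `S 0`, one obtains a diagram equivalent to `S
0` with outline `S i` (`exists_equi_outline`). Exchange moves are reversible, so the diagrams found
for different `i` are equivalent to each other by way of `S 0`, and this is all that the lemma asks.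
Isotopies are absorbed at the end (`Equi.exists_exchanges`, `IsOutline.of_sameUpToIsotopy`).

Moves are studied on a fixed set of lines with a fixed incidence relation, only the position
function varying; this keeps the names of the edges constant along a sequence of moves. -/

namespace RectDiagram

/-! ### Position functions on a fixed set of lines, and their exchange moves -/

section Positions

variable {W : Finset Line} {N : Line → Line → Line → Prop} {f g h : Line → ℝ}

/-- Parallel lines of `W` have different positions. -/
def Valid (W : Finset Line) (f : Line → ℝ) : Prop :=
  ∀ a ∈ W, ∀ b ∈ W, a.vert = b.vert → f a = f b → a = b

/-- The positions `g` order parallel lines of `W` as the positions `f` do. -/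
def OrdEq (W : Finset Line) (f g : Line → ℝ) : Prop :=
  ∀ a ∈ W, ∀ b ∈ W, a.vert = b.vert → f a < f b → g a < g b

/-- No line of `W` parallel to `a` has a position strictly between those of `a` and `b`. -/
def NoneBtw (W : Finset Line) (f : Line → ℝ) (a b : Line) : Prop :=
  ∀ k ∈ W, k.vert = a.vert → f k ∉ Set.uIoo (f a) (f b)

/-- All lines of `W` parallel to `a` have positions between those of `a` and `b`. -/
def AllBtw (W : Finset Line) (f : Line → ℝ) (a b : Line) : Prop :=
  ∀ k ∈ W, k.vert = a.vert → f k ∈ Set.uIcc (f a) (f b)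

/-- The ends of `a` and `b` alternate; `N a p n` says that `p`, `n` are the ends of `a`. -/
def Inter (N : Line → Line → Line → Prop) (f : Line → ℝ) (a b : Line) : Prop :=
  ∃ p n p' n' : Line, N a p n ∧ N b p' n' ∧ Alternate (f p) (f n) (f p') (f n')

/-- Exchange move on positions. -/
def ExAt (W : Finset Line) (N : Line → Line → Line → Prop) (f g : Line → ℝ) : Prop :=
  ∃ a ∈ W, ∃ b ∈ W, a ≠ b ∧ a.vert = b.vert ∧ (NoneBtw W f a b ∨ AllBtw W f a b) ∧
    ¬ Inter N f a b ∧ OrdEq W (f ∘ Equiv.swap a b) g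

/-- An exchange move or an isotopy, on positions. -/
def Step (W : Finset Line) (N : Line → Line → Line → Prop) (f g : Line → ℝ) : Prop :=
  Valid W f ∧ Valid W g ∧ (OrdEq W f g ∨ ExAt W N f g)

/-- The positions `g` are obtained from `f` by exchange moves and isotopies. -/
def Reach (W : Finset Line) (N : Line → Line → Line → Prop) : (Line → ℝ) → (Line → ℝ) → Prop :=
  Relation.ReflTransGen (Step W N)

/-- The ends of a line are lines perpendicular to it. -/
def Perp (W : Finset Line) (N : Line → Line → Line → Prop) : Prop :=
  ∀ a p q, N a p q → p ∈ W ∧ q ∈ W ∧ p.vert ≠ a.vert ∧ q.vert ≠ a.vert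

theorem vert_eq_of_ne {a b c : Line} (h : a.vert ≠ c.vert) (h' : b.vert ≠ c.vert) :
    a.vert = b.vert := by
  cases ha : a.vert <;> cases hb : b.vert <;> cases hc : c.vert <;> simp_all

/-- Alternation involves only comparisons of an end of one edge with an end of the other; the order
of the two ends of a single edge never enters. -/
theorem Alternate.congr {p n p' n' q m q' m' : ℝ} (h : Alternate p n p' n')
    (h1 : p < p' → q < q') (h2 : p' < p → q' < q) (h3 : p < n' → q < m') (h4 : n' < p → m' < q)
    (h5 : n < p' → m < q') (h6 : p' < n → q' < m) (h7 : n < n' → m < m') (h8 : n' < n → m' < m) :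
    Alternate q m q' m' := by
  refine Or.imp (And.imp ?_ (And.imp ?_ ?_)) (And.imp ?_ (And.imp ?_ ?_)) h <;>
  · simp only [lt_min_iff, min_lt_iff, max_lt_iff, lt_max_iff]
    clear h
    grind only

theorem OrdEq.lt_iff (hf : Valid W f) (h : OrdEq W f g) {a b : Line} (ha : a ∈ W) (hb : b ∈ W)
    (hab : a.vert = b.vert) : g a < g b ↔ f a < f b := by
  refine ⟨fun hg => ?_, h a ha b hb hab⟩
  rcases lt_trichotomy (f a) (f b) with h1 | h1 | h1
  · exact h1
  · rw [hf a ha b hb hab h1] at hg; exact absurd hg (lt_irrefl _)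
  · exact absurd (h b hb a ha hab.symm h1) hg.asymm

theorem OrdEq.symm (hf : Valid W f) (h : OrdEq W f g) : OrdEq W g f :=
  fun _ ha _ hb hab => (h.lt_iff hf ha hb hab).1

theorem OrdEq.trans (h₁ : OrdEq W f g) (h₂ : OrdEq W g h) : OrdEq W f h :=
  fun a ha b hb hab hl => h₂ a ha b hb hab (h₁ a ha b hb hab hl)

theorem OrdEq.valid (hf : Valid W f) (h : OrdEq W f g) : Valid W g := by
  intro a ha b hb hab hg
  rcases lt_trichotomy (f a) (f b) with h1 | h1 | h1
  · exact absurd hg (h a ha b hb hab h1).ne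
  · exact hf a ha b hb hab h1
  · exact absurd hg (h b hb a ha hab.symm h1).ne'

theorem swap_mem {a b k : Line} (ha : a ∈ W) (hb : b ∈ W) (hk : k ∈ W) :
    Equiv.swap a b k ∈ W := by
  rw [Equiv.swap_apply_def]; split_ifs <;> assumption

theorem swap_vert {a b : Line} (hab : a.vert = b.vert) (k : Line) :
    (Equiv.swap a b k).vert = k.vert := by
  rw [Equiv.swap_apply_def]; split_ifs <;> simp_all

theorem Valid.swap (hf : Valid W f) {a b : Line} (ha : a ∈ W) (hb : b ∈ W)
    (hab : a.vert = b.vert) : Valid W (f ∘ Equiv.swap a b) := by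
  intro k hk l hl hkl he
  exact (Equiv.swap a b).injective (hf _ (swap_mem ha hb hk) _ (swap_mem ha hb hl)
    (by rw [swap_vert hab, swap_vert hab, hkl]) he)

theorem Inter.congr (hN : Perp W N) {a b : Line} (hab : a.vert = b.vert) (h : Inter N f a b)
    (hfg : ∀ k ∈ W, ∀ l ∈ W, k.vert ≠ a.vert → l.vert ≠ a.vert → f k < f l → g k < g l) :
    Inter N g a b := by
  obtain ⟨p, n, p', n', h1, h2, h3⟩ := h
  obtain ⟨a1, a2, a3, a4⟩ := hN _ _ _ h1
  obtain ⟨b1, b2, b3, b4⟩ := hN _ _ _ h2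
  rw [← hab] at b3 b4
  refine ⟨p, n, p', n', h1, h2, h3.congr ?_ ?_ ?_ ?_ ?_ ?_ ?_ ?_⟩ <;> apply hfg <;> assumption

/-- The swap is an involution, betweenness relative to `a` and `b` is symmetric in them, and
interleaving depends only on the perpendicular lines, whose order the swap does not touch. -/
theorem ExAt.symm (hN : Perp W N) (hf : Valid W f) (hE : ExAt W N f g) : ExAt W N g f := by
  obtain ⟨a, ha, b, hb, hne, hab, hbt, hI, ho⟩ := hE
  have hs : Valid W (f ∘ Equiv.swap a b) := hf.swap ha hb hab
  have key : ∀ k ∈ W, ∀ l ∈ W, k.vert = l.vert →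
      (g k < g l ↔ f (Equiv.swap a b k) < f (Equiv.swap a b l)) :=
    fun k hk l hl hkl => ho.lt_iff hs hk hl hkl
  have sa : Equiv.swap a b a = b := Equiv.swap_apply_left a b
  have sb : Equiv.swap a b b = a := Equiv.swap_apply_right a b
  refine ⟨a, ha, b, hb, hne, hab, ?_, ?_, ?_⟩
  · rcases hbt with h | h
    · left
      intro k hk hka hgk
      have h1 := key k hk a ha hka
      have h2 := key a ha k hk hka.symm
      have h3 := key k hk b hb (hka.trans hab)
      have h4 := key b hb k hk (hka.trans hab).symm
      rw [sa] at h1 h2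
      rw [sb] at h3 h4
      have := h _ (swap_mem ha hb hk) (by rw [swap_vert hab, hka])
      simp only [Set.uIoo, Set.mem_Ioo, min_lt_iff, lt_max_iff] at this hgk
      tauto
    · right
      intro k hk hka
      have h1 := key k hk a ha hka
      have h2 := key a ha k hk hka.symm
      have h3 := key k hk b hb (hka.trans hab)
      have h4 := key b hb k hk (hka.trans hab).symm
      rw [sa] at h1 h2
      rw [sb] at h3 h4
      have := h _ (swap_mem ha hb hk) (by rw [swap_vert hab, hka])
      simp only [Set.mem_uIcc, ← not_lt] at this ⊢
      tauto
  · intro hI'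
    refine hI (hI'.congr hN hab fun k hk l hl hka hla hkl => ?_)
    have := (key k hk l hl (vert_eq_of_ne hka hla)).1 hkl
    rwa [Equiv.swap_apply_of_ne_of_ne, Equiv.swap_apply_of_ne_of_ne] at this <;>
      rintro rfl <;> simp_all
  · intro k hk l hl hkl hlt
    have := (key _ (swap_mem ha hb hk) _ (swap_mem ha hb hl)
      (by rw [swap_vert hab, swap_vert hab, hkl])).1 hlt
    simpa using this

theorem ExAt.valid (hf : Valid W f) (hE : ExAt W N f g) : Valid W g := by
  obtain ⟨a, ha, b, hb, hne, hab, hbt, hI, ho⟩ := hE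
  exact ho.valid (hf.swap ha hb hab)

theorem Step.symm (hN : Perp W N) (h : Step W N f g) : Step W N g f :=
  ⟨h.2.1, h.1, h.2.2.imp (fun h' => h'.symm h.1) (fun h' => h'.symm hN h.1)⟩

theorem Reach.symm (hN : Perp W N) (h : Reach W N f g) : Reach W N g f := by
  induction h with
  | refl => exact .refl
  | tail _ h2 ih => exact .head (h2.symm hN) ih

theorem Reach.valid (h : Reach W N f g) (hf : Valid W f) : Valid W g := by
  induction h with
  | refl => exact hf
  | tail _ h2 _ => exact h2.2.1

theorem Reach.of_ordEq (hf : Valid W f) (h : OrdEq W f g) : Reach W N f g :=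
  .single ⟨hf, h.valid hf, .inl h⟩

/-! ### Free movement of edges whose ends are adjacent or extreme -/

theorem NoneBtw.symm {a b : Line} (hab : a.vert = b.vert) (h : NoneBtw W f a b) :
    NoneBtw W f b a := by
  intro k hk hkb
  rw [Set.uIoo_comm]
  exact h k hk (hkb.trans hab.symm)

theorem AllBtw.symm {a b : Line} (hab : a.vert = b.vert) (h : AllBtw W f a b) :
    AllBtw W f b a := by
  intro k hk hkb
  rw [Set.uIcc_comm]
  exact h k hk (hkb.trans hab.symm)

theorem Alternate.symm {p n p' n' : ℝ} (h : Alternate p n p' n') : Alternate p' n' p n :=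
  Or.symm h

theorem Inter.symm {a b : Line} (h : Inter N f a b) : Inter N f b a := by
  obtain ⟨p, n, p', n', h1, h2, h3⟩ := h
  exact ⟨p', n', p, n, h2, h1, h3.symm⟩

/-- An edge whose ends are adjacent or extreme is not interleaved with any other one. -/
theorem not_inter_of_short (hN : Perp W N) {n b : Line} (hnb : n.vert = b.vert)
    (hs : ∀ p q, N n p q → NoneBtw W f p q ∨ AllBtw W f p q) : ¬ Inter N f n b := by
  rintro ⟨p, q, p', q', h1, h2, h3⟩
  obtain ⟨a1, a2, a3, a4⟩ := hN _ _ _ h1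
  obtain ⟨b1, b2, b3, b4⟩ := hN _ _ _ h2
  rw [← hnb] at b3 b4
  have hp := vert_eq_of_ne b3 a3
  have hq := vert_eq_of_ne b4 a3
  rcases hs p q h1 with h | h
  · have u := h p' b1 hp
    have v := h q' b2 hq
    simp only [Set.uIoo, Set.mem_Ioo, not_and_or, not_lt] at u v
    simp only [Alternate, lt_min_iff, min_lt_iff, max_lt_iff, lt_max_iff] at h3
    simp only [le_min_iff, max_le_iff] at u v
    grind
  · have u := h p' b1 hp
    have v := h q' b2 hq
    simp only [Set.mem_uIcc] at u v
    simp only [Alternate, lt_min_iff, min_lt_iff, max_lt_iff, lt_max_iff] at h3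
    grind

/-- There are positions arbitrarily close to a given one, on either side. -/
theorem exists_near (W : Finset Line) (f : Line → ℝ) (v : ℝ) (up : Bool) :
    ∃ t, (up = true → v < t) ∧ (up = false → t < v) ∧
      ∀ k ∈ W, (v < f k → t < f k) ∧ (f k < v → f k < t) := by
  obtain ⟨ε, hε, h⟩ : ∃ ε > 0, ∀ k ∈ W, f k ≠ v → ε < |f k - v| := by
    induction W using Finset.induction_on with
    | empty => exact ⟨1, one_pos, by simp⟩
    | insert a s _ ih =>
      obtain ⟨ε, hε, h⟩ := ih
      by_cases ha : f a = v
      · refine ⟨ε, hε, fun k hk hne => ?_⟩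
        rcases Finset.mem_insert.1 hk with rfl | hk
        · exact absurd ha hne
        · exact h k hk hne
      · have hpos : 0 < |f a - v| := abs_pos.2 (sub_ne_zero.2 ha)
        refine ⟨min ε (|f a - v| / 2), lt_min hε (by linarith), fun k hk hne => ?_⟩
        rcases Finset.mem_insert.1 hk with rfl | hk
        · exact (min_le_right _ _).trans_lt (by linarith)
        · exact (min_le_left _ _).trans_lt (h k hk hne)
  have h' : ∀ k ∈ W, (v < f k → ε < f k - v) ∧ (f k < v → ε < v - f k) := by
    refine fun k hk => ⟨fun hl => ?_, fun hl => ?_⟩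
    · have := h k hk hl.ne'
      rwa [abs_of_pos (by linarith)] at this
    · have := h k hk hl.ne
      rwa [abs_of_neg (by linarith), neg_sub] at this
  cases up
  · exact ⟨v - ε, by simp, fun _ => by linarith,
      fun k hk => ⟨fun hl => by linarith, fun hl => by linarith [(h' k hk).2 hl]⟩⟩
  · exact ⟨v + ε, fun _ => by linarith, by simp,
      fun k hk => ⟨fun hl => by linarith [(h' k hk).1 hl], fun hl => by linarith⟩⟩

theorem Valid.update (hf : Valid W f) {n : Line} {t : ℝ}
    (ht : ∀ k ∈ W, k.vert = n.vert → k ≠ n → f k ≠ t) : Valid W (Function.update f n t) := by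
  intro a ha b hb hab he
  by_cases h1 : a = n <;> by_cases h2 : b = n
  · rw [h1, h2]
  · subst h1
    rw [Function.update_self, Function.update_of_ne h2] at he
    exact absurd he.symm (ht b hb hab.symm h2)
  · subst h2
    rw [Function.update_self, Function.update_of_ne h1] at he
    exact absurd he (ht a ha hab h1)
  · rw [Function.update_of_ne h1, Function.update_of_ne h2] at he
    exact hf a ha b hb hab he

theorem Valid.ne_of_update {n k : Line} {t : ℝ} (hf : Valid W (Function.update f n t))
    (hn : n ∈ W) (hk : k ∈ W) (hkn : k.vert = n.vert) (hne : k ≠ n) : f k ≠ t := by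
  intro he
  apply hne
  apply hf k hk n hn hkn
  rw [Function.update_self, Function.update_of_ne hne, he]

/-- A line moves freely across positions that are not occupied. -/
theorem reach_of_no_line_between {n : Line} {t : ℝ} (hf : Valid W f)
    (hft : Valid W (Function.update f n t)) (hn : n ∈ W)
    (hb : ∀ k ∈ W, k.vert = n.vert → k ≠ n → (f k < f n ↔ f k < t)) :
    Reach W N f (Function.update f n t) := by
  refine .of_ordEq hf fun k hk l hl hkl hlt => ?_
  by_cases h1 : k = n <;> by_cases h2 : l = n
  · subst h1; subst h2; exact absurd hlt (lt_irrefl _)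
  · subst h1
    rw [Function.update_self, Function.update_of_ne h2]
    have := hft.ne_of_update hn hl hkl.symm h2
    exact lt_of_le_of_ne (not_lt.1 fun h' => hlt.asymm ((hb l hl hkl.symm h2).2 h')) this.symm
  · subst h2
    rw [Function.update_self, Function.update_of_ne h1]
    exact (hb k hk hkl h1).1 hlt
  · rwa [Function.update_of_ne h1, Function.update_of_ne h2]

/-- Induction on the number of parallel lines to be overtaken: one exchange with the nearest line
`b` above `n` brings `n` just past `b`. The ends of `n` are perpendicular to it, so they stay
adjacent or extreme. -/
theorem reach_update_of_lt (hN : Perp W N) {n : Line} (hn : n ∈ W) (m : ℕ) : ∀ {f : Line → ℝ}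
    {t : ℝ}, Valid W f → Valid W (Function.update f n t) →
    (∀ p q, N n p q → NoneBtw W f p q ∨ AllBtw W f p q) → f n < t →
    (W.filter fun k => k.vert = n.vert ∧ f n < f k ∧ f k < t).card = m →
    Reach W N f (Function.update f n t) := by
  induction m with
  | zero =>
    intro f t hf hft hs hlt hc
    rw [Finset.card_eq_zero, Finset.filter_eq_empty_iff] at hc
    refine reach_of_no_line_between hf hft hn fun k hk hkn hne => ⟨fun h => h.trans hlt, fun h => ?_⟩
    have h1 := hc hk
    have h2 : f k ≠ f n := fun he => hne (hf k hk n hn hkn he)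
    by_contra h3
    exact h1 ⟨hkn, lt_of_le_of_ne (not_lt.1 h3) h2.symm, h⟩
  | succ m ih =>
    intro f t hf hft hs hlt hc
    obtain ⟨b, hbm, hmin⟩ := Finset.exists_min_image _ f
      (Finset.card_pos.1 (by rw [hc]; exact m.succ_pos))
    obtain ⟨hb, hbn, hnb, hbt⟩ := Finset.mem_filter.1 hbm
    -- Giving `n` the position `t` here makes the point just above `b` also lie below the target
    -- `t`.
    obtain ⟨t', ht1, -, ht2⟩ := exists_near (insert n W) (Function.update f n t) (f b) true
    have hbt' := ht1 rfl
    have hne : b ≠ n := by rintro rfl; exact lt_irrefl _ hnb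
    have ht't : t' < t := by
      have := (ht2 n (Finset.mem_insert_self _ _)).1
      rw [Function.update_self] at this
      exact this hbt
    have hk : ∀ k ∈ W, k ≠ n → (f b < f k → t' < f k) ∧ (f k < f b → f k < t') := by
      intro k hk hkn
      have := ht2 k (Finset.mem_insert_of_mem hk)
      rwa [Function.update_of_ne hkn] at this
    have hft' : Valid W (Function.update f n t') := by
      refine hf.update fun k hkW hkn hkne => ?_
      rcases lt_trichotomy (f k) (f b) with h1 | h1 | h1
      · exact ((hk k hkW hkne).2 h1).ne
      · exact (h1.trans_lt hbt').ne
      · exact ((hk k hkW hkne).1 h1).ne'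
    have hnone : NoneBtw W f n b := by
      intro k hkW hkn hkk
      rw [Set.uIoo_of_lt hnb] at hkk
      have := hmin k (Finset.mem_filter.2 ⟨hkW, hkn, hkk.1, hkk.2.trans hbt⟩)
      exact absurd hkk.2 (not_lt.2 this)
    have hstep : Reach W N f (Function.update f n t') := by
      refine .single ⟨hf, hft', .inr ⟨n, hn, b, hb, hne.symm, hbn.symm, .inl hnone,
        not_inter_of_short hN hbn.symm hs, ?_⟩⟩
      have hval : ∀ k ∈ W, k.vert = n.vert → k ≠ n → k ≠ b →
          (f k < f n ∨ f b < f k) := by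
        intro k hkW hkn h1 h2
        by_contra! hcon
        have e1 : f k ≠ f n := fun he => h1 (hf k hkW n hn hkn he)
        have e2 : f k ≠ f b := fun he => h2 (hf k hkW b hb (hkn.trans hbn.symm) he)
        refine hnone k hkW hkn ?_
        rw [Set.uIoo_of_lt hnb]
        exact ⟨lt_of_le_of_ne hcon.1 e1.symm, lt_of_le_of_ne hcon.2 e2⟩
      intro k hkW l hl hkl hlt
      simp only [Function.comp_apply] at hlt
      by_cases k1 : k = n
      · subst k1
        rw [Equiv.swap_apply_left] at hlt
        rw [Function.update_self]
        by_cases l1 : l = k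
        · subst l1; rw [Equiv.swap_apply_left] at hlt; exact absurd hlt (lt_irrefl _)
        rw [Function.update_of_ne l1]
        by_cases l2 : l = b
        · subst l2; rw [Equiv.swap_apply_right] at hlt; exact absurd hlt hnb.asymm
        rw [Equiv.swap_apply_of_ne_of_ne l1 l2] at hlt
        exact (hk l hl l1).1 hlt
      rw [Function.update_of_ne k1]
      by_cases l1 : l = n
      · subst l1
        rw [Equiv.swap_apply_left] at hlt
        rw [Function.update_self]
        by_cases k2 : k = b
        · subst k2; exact hbt'
        rw [Equiv.swap_apply_of_ne_of_ne k1 k2] at hlt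
        exact hlt.trans hbt'
      rw [Function.update_of_ne l1]
      by_cases k2 : k = b
      · subst k2
        rw [Equiv.swap_apply_right] at hlt
        by_cases l2 : l = k
        · subst l2; rw [Equiv.swap_apply_right] at hlt; exact absurd hlt (lt_irrefl _)
        rw [Equiv.swap_apply_of_ne_of_ne l1 l2] at hlt
        exact (hval l hl (hkl.symm.trans hbn) l1 l2).resolve_left hlt.asymm
      rw [Equiv.swap_apply_of_ne_of_ne k1 k2] at hlt
      by_cases l2 : l = b
      · subst l2
        rw [Equiv.swap_apply_right] at hlt
        exact hlt.trans hnb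
      rwa [Equiv.swap_apply_of_ne_of_ne l1 l2] at hlt
    have hup : Function.update (Function.update f n t') n t = Function.update f n t :=
      Function.update_idem _ _ _
    refine hstep.trans ?_
    rw [← hup]
    refine ih hft' (hup ▸ hft) ?_ (by rwa [Function.update_self]) ?_
    · intro p q hpq
      obtain ⟨a1, a2, a3, a4⟩ := hN _ _ _ hpq
      have hpn : p ≠ n := by rintro rfl; exact a3 rfl
      have hqn : q ≠ n := by rintro rfl; exact a4 rfl
      refine (hs p q hpq).imp (fun h k hkW hkp => ?_) (fun h k hkW hkp => ?_) <;>
      · have hkn : k ≠ n := by rintro rfl; exact a3 hkp.symm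
        rw [Function.update_of_ne hpn, Function.update_of_ne hqn, Function.update_of_ne hkn]
        exact h k hkW hkp
    · have : (W.filter fun k => k.vert = n.vert ∧ f n < f k ∧ f k < t) =
          insert b (W.filter fun k => k.vert = n.vert ∧ Function.update f n t' n <
            Function.update f n t' k ∧ Function.update f n t' k < t) := by
        ext k
        simp only [Finset.mem_filter, Finset.mem_insert, Function.update_self]
        by_cases hkn : k = n
        · subst hkn; simp [hne.symm]
        rw [Function.update_of_ne hkn]
        constructor
        · rintro ⟨c1, c2, c3, c4⟩
          by_cases hkb : k = b
          · exact .inl hkb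
          have := hmin k (Finset.mem_filter.2 ⟨c1, c2, c3, c4⟩)
          have e2 : f k ≠ f b := fun he => hkb (hf k c1 b hb (c2.trans hbn.symm) he)
          exact .inr ⟨c1, c2, (hk k c1 hkn).1 (lt_of_le_of_ne this e2.symm), c4⟩
        · rintro (rfl | ⟨c1, c2, c3, c4⟩)
          · exact ⟨hb, hbn, hnb, hbt⟩
          · exact ⟨c1, c2, hnb.trans (hbt'.trans c3), c4⟩
      rw [this, Finset.card_insert_of_notMem, Nat.add_right_cancel_iff] at hc
      · exact hc
      · simp only [Finset.mem_filter, Function.update_self, Function.update_of_ne hne]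
        rintro ⟨-, -, h1, -⟩
        exact hbt'.asymm h1

/-- Changing the position of a line does not affect what lies between lines perpendicular to it. -/
theorem between_update {n p q : Line} {t : ℝ} (hp : p.vert ≠ n.vert) (hq : q.vert ≠ n.vert)
    (h : NoneBtw W f p q ∨ AllBtw W f p q) :
    NoneBtw W (Function.update f n t) p q ∨ AllBtw W (Function.update f n t) p q := by
  have hpn : p ≠ n := by rintro rfl; exact hp rfl
  have hqn : q ≠ n := by rintro rfl; exact hq rfl
  refine h.imp (fun h k hkW hkp => ?_) (fun h k hkW hkp => ?_) <;>
  · have hkn : k ≠ n := by rintro rfl; exact hp hkp.symm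
    rw [Function.update_of_ne hpn, Function.update_of_ne hqn, Function.update_of_ne hkn]
    exact h k hkW hkp

/-- An edge whose ends are adjacent or extreme can be moved to any free position. -/
theorem reach_update (hN : Perp W N) {n : Line} (hn : n ∈ W) {t : ℝ} (hf : Valid W f)
    (hft : Valid W (Function.update f n t))
    (hs : ∀ p q, N n p q → NoneBtw W f p q ∨ AllBtw W f p q) :
    Reach W N f (Function.update f n t) := by
  rcases lt_trichotomy (f n) t with h | h | h
  · exact reach_update_of_lt hN hn _ hf hft hs h rfl
  · rw [← h, Function.update_eq_self]; exact .refl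
  -- A downward movement is the reverse of an upward one.
  · have e : Function.update (Function.update f n t) n (f n) = f := by
      rw [Function.update_idem, Function.update_eq_self]
    have := reach_update_of_lt hN hn _ hft (t := f n) (by rwa [e]) ?_
      (by rwa [Function.update_self]) rfl
    · rw [e] at this; exact this.symm hN
    · intro p q hpq
      obtain ⟨-, -, a3, a4⟩ := hN _ _ _ hpq
      exact between_update a3 a4 (hs p q hpq)

end Positions

end RectDiagram

namespace RectDiagram

/-! ### Two lines inserted at a corner -/

section Corners

variable {W₀ W : Finset Line} {N₀ N : Line → Line → Line → Prop} {f g : Line → ℝ}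
  {x n₁ n₂ y : Line}

/-- The lines `W` with ends `N` are obtained from the lines `W₀` with ends `N₀` by inserting two
lines `n₁`, `n₂` between the successive lines `x`, `y`. -/
structure Corner (W₀ W : Finset Line) (N₀ N : Line → Line → Line → Prop) (x n₁ n₂ y : Line) :
    Prop where
  mem_iff : ∀ k, k ∈ W ↔ k = n₁ ∨ k = n₂ ∨ k ∈ W₀
  x_mem : x ∈ W₀
  y_mem : y ∈ W₀
  n₁_notMem : n₁ ∉ W₀
  n₂_notMem : n₂ ∉ W₀
  n₁_vert : n₁.vert = y.vert
  n₂_vert : n₂.vert = x.vert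
  vert_ne : x.vert ≠ y.vert
  perp : Perp W N
  perp₀ : Perp W₀ N₀
  ends_n₁ : ∀ p q, N n₁ p q → (p = x ∧ q = n₂) ∨ (p = n₂ ∧ q = x)
  ends_n₂ : ∀ p q, N n₂ p q → (p = n₁ ∧ q = y) ∨ (p = y ∧ q = n₁)
  ends_x : ∀ p q, N x p q → (p = n₁ ∧ N₀ x y q) ∨ (q = n₁ ∧ N₀ x y p)
  ends_y : ∀ p q, N y p q → (p = n₂ ∧ N₀ y x q) ∨ (q = n₂ ∧ N₀ y x p)
  ends_other : ∀ a p q, a ≠ x → a ≠ n₁ → a ≠ n₂ → a ≠ y → N a p q → N₀ a p q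
  ends_unique : ∀ a p q p' q', N₀ a p q → N₀ a p' q' → (p = p' ∧ q = q') ∨ (p = q' ∧ q = p')

/-- Nothing about a corner depends on the orientation of the curve, so statements proved for `x` and
`n₂` transfer to `y` and `n₁`. -/
theorem Corner.symm (C : Corner W₀ W N₀ N x n₁ n₂ y) : Corner W₀ W N₀ N y n₂ n₁ x where
  mem_iff k := by rw [C.mem_iff]; tauto
  x_mem := C.y_mem
  y_mem := C.x_mem
  n₁_notMem := C.n₂_notMem
  n₂_notMem := C.n₁_notMem
  n₁_vert := C.n₂_vert
  n₂_vert := C.n₁_vert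
  vert_ne := C.vert_ne.symm
  perp := C.perp
  perp₀ := C.perp₀
  ends_n₁ p q h := (C.ends_n₂ p q h).symm
  ends_n₂ p q h := (C.ends_n₁ p q h).symm
  ends_x := C.ends_y
  ends_y := C.ends_x
  ends_other a p q h1 h2 h3 h4 := C.ends_other a p q h4 h3 h2 h1
  ends_unique := C.ends_unique

/-- `n₁` is next to `y` and `n₂` is next to `x`. -/
structure Good (W : Finset Line) (f : Line → ℝ) (x n₁ n₂ y : Line) : Prop where
  valid : Valid W f
  near₁ : NoneBtw W f n₁ y
  near₂ : NoneBtw W f n₂ x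

theorem Good.symm (h : Good W f x n₁ n₂ y) : Good W f y n₂ n₁ x := ⟨h.valid, h.near₂, h.near₁⟩

/-- `t` lies next to `v`, on the side given by `up`. -/
structure NextTo (W : Finset Line) (f : Line → ℝ) (v t : ℝ) (up : Bool) : Prop where
  lt : up = true → v < t
  gt : up = false → t < v
  near : ∀ k ∈ W, (v < f k → t < f k) ∧ (f k < v → f k < t)

theorem exists_nextTo (W : Finset Line) (f : Line → ℝ) (v : ℝ) (up : Bool) :
    ∃ t, NextTo W f v t up :=
  let ⟨t, h1, h2, h3⟩ := exists_near W f v up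
  ⟨t, h1, h2, h3⟩

theorem NextTo.ne {v t : ℝ} {up : Bool} (h : NextTo W f v t up) : t ≠ v := by
  cases up
  · exact (h.gt rfl).ne
  · exact (h.lt rfl).ne'

theorem NextTo.apply_ne {v t : ℝ} {up : Bool} (h : NextTo W f v t up) {k : Line} (hk : k ∈ W) :
    f k ≠ t := by
  rcases lt_trichotomy (f k) v with h1 | h1 | h1
  · exact ((h.near k hk).2 h1).ne
  · rw [h1]; exact h.ne.symm
  · exact ((h.near k hk).1 h1).ne'

theorem NextTo.valid {t : ℝ} {up : Bool} {v : ℝ} (hf : Valid W f) (h : NextTo W f v t up)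
    (n : Line) : Valid W (Function.update f n t) :=
  hf.update fun _ hk _ _ => h.apply_ne hk

theorem NextTo.noneBtw {t : ℝ} {up : Bool} {n : Line} (h : NextTo W f (f y) t up)
    (hny : n ≠ y) : NoneBtw W (Function.update f n t) n y := by
  intro k hk _
  rw [Function.update_self, Function.update_of_ne hny.symm]
  by_cases hkn : k = n
  · subst hkn; rw [Function.update_self]; simpa [Set.uIoo] using le_of_lt
  rw [Function.update_of_ne hkn]
  simp only [Set.uIoo, Set.mem_Ioo, min_lt_iff, lt_max_iff]
  have := h.near k hk
  grind

namespace Corner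

theorem x_mem' (C : Corner W₀ W N₀ N x n₁ n₂ y) : x ∈ W := (C.mem_iff _).2 (.inr (.inr C.x_mem))
theorem y_mem' (C : Corner W₀ W N₀ N x n₁ n₂ y) : y ∈ W := (C.mem_iff _).2 (.inr (.inr C.y_mem))
theorem n₁_mem (C : Corner W₀ W N₀ N x n₁ n₂ y) : n₁ ∈ W := (C.mem_iff _).2 (.inl rfl)
theorem n₂_mem (C : Corner W₀ W N₀ N x n₁ n₂ y) : n₂ ∈ W := (C.mem_iff _).2 (.inr (.inl rfl))
theorem mem_of_mem (C : Corner W₀ W N₀ N x n₁ n₂ y) {k : Line} (hk : k ∈ W₀) : k ∈ W :=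
  (C.mem_iff _).2 (.inr (.inr hk))
theorem ne₁ (C : Corner W₀ W N₀ N x n₁ n₂ y) {k : Line} (hk : k ∈ W₀) : k ≠ n₁ := by
  rintro rfl; exact C.n₁_notMem hk
theorem ne₂ (C : Corner W₀ W N₀ N x n₁ n₂ y) {k : Line} (hk : k ∈ W₀) : k ≠ n₂ := by
  rintro rfl; exact C.n₂_notMem hk

/-- Moving `n₁` to a position next to any given one. -/
theorem move₁ (C : Corner W₀ W N₀ N x n₁ n₂ y) (hf : Valid W f)
    (hs : NoneBtw W f n₂ x ∨ AllBtw W f n₂ x) {t : ℝ} (ht : Valid W (Function.update f n₁ t)) :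
    Reach W N f (Function.update f n₁ t) := by
  refine reach_update C.perp C.n₁_mem hf ht fun p q hpq => ?_
  rcases C.ends_n₁ p q hpq with ⟨rfl, rfl⟩ | ⟨rfl, rfl⟩
  · exact hs.imp (fun h => h.symm C.n₂_vert) (fun h => h.symm C.n₂_vert)
  · exact hs

theorem noneBtw_update (C : Corner W₀ W N₀ N x n₁ n₂ y) {t : ℝ} (h : NoneBtw W f n₂ x) :
    NoneBtw W (Function.update f n₁ t) n₂ x := by
  have v : x.vert ≠ n₁.vert := by rw [C.n₁_vert]; exact C.vert_ne
  intro k hk hkv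
  have e : ∀ a : Line, a.vert = x.vert → Function.update f n₁ t a = f a := fun a ha =>
    Function.update_of_ne (by rintro rfl; exact v ha.symm) _ _
  rw [e k (hkv.trans C.n₂_vert), e _ C.n₂_vert, e x rfl]
  exact h k hk hkv

/-- If one of the inserted lines has adjacent or extreme ends, then both can be brought to their
places, on any side. -/
theorem exists_good (C : Corner W₀ W N₀ N x n₁ n₂ y) (hf : Valid W f)
    (hs : NoneBtw W f n₂ x ∨ AllBtw W f n₂ x) (up₁ up₂ : Bool) :
    ∃ g, Reach W N f g ∧ Good W g x n₁ n₂ y ∧ (∀ k ∈ W₀, g k = f k) ∧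
      NextTo W₀ f (f y) (g n₁) up₁ ∧ NextTo W₀ f (f x) (g n₂) up₂ := by
  have n12 : n₁ ≠ n₂ := by
    intro h; apply C.vert_ne; rw [← C.n₁_vert, ← C.n₂_vert, h]
  -- The hypothesis frees `n₁`, whose ends are `x` and `n₂`. Once `n₁` is next to `y`, the ends of
  -- `n₂` are adjacent, so `n₂` becomes free as well.
  obtain ⟨t₁, h₁⟩ := exists_nextTo W f (f y) up₁
  have r₁ := C.move₁ hf hs (h₁.valid hf n₁)
  have b₁ : NoneBtw W (Function.update f n₁ t₁) n₁ y := h₁.noneBtw (C.ne₁ C.y_mem).symm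
  have hf₁ := r₁.valid hf
  obtain ⟨t₂, h₂⟩ := exists_nextTo W (Function.update f n₁ t₁) (Function.update f n₁ t₁ x) up₂
  have r₂ := C.symm.move₁ hf₁ (.inl b₁) (h₂.valid hf₁ n₂)
  have e : ∀ k ∈ W₀, Function.update f n₁ t₁ k = f k :=
    fun k hk => Function.update_of_ne (C.ne₁ hk) _ _
  refine ⟨_, r₁.trans r₂, ⟨r₂.valid hf₁, C.symm.noneBtw_update b₁,
    h₂.noneBtw (C.ne₂ C.x_mem).symm⟩, fun k hk => ?_, ?_, ?_⟩
  · rw [Function.update_of_ne (C.ne₂ hk), e k hk]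
  · rw [Function.update_of_ne n12, Function.update_self]
    exact ⟨h₁.lt, h₁.gt, fun k hk => h₁.near k (C.mem_of_mem hk)⟩
  · rw [Function.update_self]
    rw [e x C.x_mem] at h₂
    refine ⟨h₂.lt, h₂.gt, fun k hk => ?_⟩
    have := h₂.near k (C.mem_of_mem hk)
    rwa [e k hk] at this

theorem exists_good' (C : Corner W₀ W N₀ N x n₁ n₂ y) (hf : Valid W f)
    (hs : NoneBtw W f n₁ y ∨ AllBtw W f n₁ y) (up₁ up₂ : Bool) :
    ∃ g, Reach W N f g ∧ Good W g x n₁ n₂ y ∧ (∀ k ∈ W₀, g k = f k) ∧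
      NextTo W₀ f (f y) (g n₁) up₁ ∧ NextTo W₀ f (f x) (g n₂) up₂ := by
  obtain ⟨g, h1, h2, h3, h4, h5⟩ := C.symm.exists_good hf hs up₂ up₁
  exact ⟨g, h1, h2.symm, h3, h5, h4⟩

/-- Positions of `W₀` extend to `W` in a given order type. -/
theorem exists_extension (C : Corner W₀ W N₀ N x n₁ n₂ y) (hf : Good W f x n₁ n₂ y)
    (ho : OrdEq W₀ f g) :
    ∃ h, OrdEq W f h ∧ ∀ k ∈ W₀, h k = g k := by
  have n12 : n₁ ≠ n₂ := by
    intro h; apply C.vert_ne; rw [← C.n₁_vert, ← C.n₂_vert, h]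
  have v12 : n₁.vert ≠ n₂.vert := by rw [C.n₁_vert, C.n₂_vert]; exact C.vert_ne.symm
  -- Each new line is put next to its neighbour on the same side as under `f`. Relative to any other
  -- line of `W₀` it is ordered as that neighbour is, so the whole order type is reproduced.
  obtain ⟨t₁, h₁⟩ := exists_nextTo W₀ g (g y) (decide (f y < f n₁))
  obtain ⟨t₂, h₂⟩ := exists_nextTo W₀ g (g x) (decide (f x < f n₂))
  have key : ∀ {y n : Line} {t : ℝ}, y ∈ W₀ → n ∈ W → n ∉ W₀ → n.vert = y.vert →
      NoneBtw W f n y → NextTo W₀ g (g y) t (decide (f y < f n)) →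
      ∀ k ∈ W₀, k.vert = n.vert → (f n < f k → t < g k) ∧ (f k < f n → g k < t) := by
    intro y n t hy hn hnW hv hbt ht k hk hkv
    have hyn : f y ≠ f n := fun he => hnW (hf.valid _ (C.mem_of_mem hy) _ hn hv.symm he ▸ hy)
    have hkn : f k ≠ f n := fun he => hnW (hf.valid _ (C.mem_of_mem hk) _ hn hkv he ▸ hk)
    have hb := hbt k (C.mem_of_mem hk) hkv
    have hkn' := ht.near k hk
    have hl := ht.lt
    have hg := ht.gt
    simp only [decide_eq_true_eq, decide_eq_false_iff_not] at hl hg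
    have o1 := ho k hk y hy (hkv.trans hv)
    have o2 := ho y hy k hk (hkv.trans hv).symm
    have o3 : f k = f y → g k = g y := fun he => by
      rw [hf.valid _ (C.mem_of_mem hk) _ (C.mem_of_mem hy) (hkv.trans hv) he]
    simp only [Set.uIoo, Set.mem_Ioo, min_lt_iff, lt_max_iff] at hb
    grind
  have k₁ := key C.y_mem C.n₁_mem C.n₁_notMem C.n₁_vert hf.near₁ h₁
  have k₂ := key C.x_mem C.n₂_mem C.n₂_notMem C.n₂_vert hf.near₂ h₂
  refine ⟨fun k => if k = n₁ then t₁ else if k = n₂ then t₂ else g k, ?_, fun k hk => ?_⟩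
  · intro a ha b hb hab hlt
    rcases (C.mem_iff a).1 ha with rfl | rfl | ha <;> rcases (C.mem_iff b).1 hb with rfl | rfl | hb
    · exact absurd hlt (lt_irrefl _)
    · exact absurd hab v12
    · simp only [if_true, if_neg (C.ne₁ hb), if_neg (C.ne₂ hb)]
      exact (k₁ b hb hab.symm).1 hlt
    · exact absurd hab.symm v12
    · exact absurd hlt (lt_irrefl _)
    · simp only [if_neg n12.symm, if_true, if_neg (C.ne₁ hb), if_neg (C.ne₂ hb)]
      exact (k₂ b hb hab.symm).1 hlt
    · simp only [if_true, if_neg (C.ne₁ ha), if_neg (C.ne₂ ha)]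
      exact (k₁ a ha hab).2 hlt
    · simp only [if_neg n12.symm, if_true, if_neg (C.ne₁ ha), if_neg (C.ne₂ ha)]
      exact (k₂ a ha hab).2 hlt
    · simp only [if_neg (C.ne₁ ha), if_neg (C.ne₂ ha), if_neg (C.ne₁ hb), if_neg (C.ne₂ hb)]
      exact ho a ha b hb hab hlt
  · simp only [if_neg (C.ne₁ hk), if_neg (C.ne₂ hk)]

end Corner

theorem NoneBtw.congr {a b : Line} (h : NoneBtw W f a b) (ha : a ∈ W) (hb : b ∈ W)
    (hab : a.vert = b.vert) (ho : OrdEq W g f) : NoneBtw W g a b := by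
  intro k hk hka hkk
  apply h k hk hka
  have h1 := ho k hk a ha hka
  have h2 := ho a ha k hk hka.symm
  have h3 := ho k hk b hb (hka.trans hab)
  have h4 := ho b hb k hk (hka.trans hab).symm
  simp only [Set.uIoo, Set.mem_Ioo, min_lt_iff, lt_max_iff] at hkk ⊢
  tauto

theorem Good.congr (C : Corner W₀ W N₀ N x n₁ n₂ y) (h : Good W f x n₁ n₂ y)
    (ho : OrdEq W f g) : Good W g x n₁ n₂ y :=
  ⟨ho.valid h.valid, h.near₁.congr C.n₁_mem C.y_mem' C.n₁_vert (ho.symm h.valid),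
    h.near₂.congr C.n₂_mem C.x_mem' C.n₂_vert (ho.symm h.valid)⟩

theorem Alternate.swap_left {p n p' n' : ℝ} (h : Alternate p n p' n') : Alternate n p p' n' := by
  rwa [Alternate, min_comm n p, max_comm n p]

/-- If `Y` is moved slightly to a suitable side, then no new alternation arises, even if `Y` is one
of the points `P'`, `Q'`. -/
theorem exists_side {P Y P' Q' : ℝ} (h : ¬ Alternate P Y P' Q') :
    ∃ up : Bool, ∀ t, (up = true → Y < t) → (up = false → t < Y) →
      (∀ v ∈ [P, P', Q'], (Y < v → t < v) ∧ (v < Y → v < t)) → ¬ Alternate P t P' Q' := by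
  -- Alternation after a small shift either way would place `Y` strictly so that it alternated
  -- already, as at most one of the two shifts can separate `Y` from a coinciding `P'` or `Q'` in
  -- the harmful way.
  by_contra! H
  obtain ⟨t, h1, -, h2, h3⟩ := H true
  obtain ⟨s, -, h4, h5, h6⟩ := H false
  simp only [List.mem_cons, List.not_mem_nil, or_false, forall_eq_or_imp, forall_eq] at h2 h5
  simp only [Alternate, lt_min_iff, min_lt_iff, max_lt_iff, lt_max_iff] at h h3 h6
  grind

end Corners

end RectDiagram

namespace RectDiagram

/-! ### Lifting exchange moves through an insertion -/

section Lifting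

variable {W₀ W : Finset Line} {N₀ N : Line → Line → Line → Prop} {f g : Line → ℝ}
  {x n₁ n₂ y : Line}

/-- There is a free position which does not obstruct the exchange of adjacent or extreme edges. -/
theorem exists_position_aside {a b : Line} (hne : f a ≠ f b)
    (h : NoneBtw W₀ f a b ∨ AllBtw W₀ f a b) (s : Finset ℝ) :
    ∃ t ∉ s, ((NoneBtw W₀ f a b ∧ t ∉ Set.uIoo (f a) (f b)) ∨
      (AllBtw W₀ f a b ∧ t ∈ Set.uIcc (f a) (f b))) := by
  rcases h with h | h
  · obtain ⟨t, ht, hts⟩ := (Set.Ioi_infinite (max (f a) (f b))).exists_notMem_finset s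
    exact ⟨t, hts, .inl ⟨h, fun h' => lt_asymm (Set.mem_Ioi.1 ht) h'.2⟩⟩
  · obtain ⟨t, ht, hts⟩ := (Set.Ioo_infinite (min_lt_max.2 hne)).exists_notMem_finset s
    exact ⟨t, hts, .inr ⟨h, ht.1.le, ht.2.le⟩⟩

namespace Corner

theorem ends_b (C : Corner W₀ W N₀ N x n₁ n₂ y) {b : Line} (hb : b ∈ W₀) (hx : b ≠ x)
    (hy : b ≠ y) {p q : Line} (h : N b p q) : N₀ b p q :=
  C.ends_other b p q hx (C.ne₁ hb) (C.ne₂ hb) hy h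

/-- Lift of an exchange of `x` with another edge. -/
theorem lift_exchange_x (C : Corner W₀ W N₀ N x n₁ n₂ y) (hf : Good W f x n₁ n₂ y) {b : Line}
    (hb : b ∈ W₀) (hbx : x ≠ b) (hv : x.vert = b.vert)
    (hbt : NoneBtw W₀ f x b ∨ AllBtw W₀ f x b) (hI : ¬ Inter N₀ f x b) :
    ∃ g, Reach W N f g ∧ Good W g x n₁ n₂ y ∧ OrdEq W₀ (f ∘ Equiv.swap x b) g := by
  have v12 : n₁.vert ≠ n₂.vert := by rw [C.n₁_vert, C.n₂_vert]; exact C.vert_ne.symm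
  have n12 : n₁ ≠ n₂ := fun h => v12 (by rw [h])
  have hby : b ≠ y := by rintro rfl; exact C.vert_ne hv
  -- With the insertion, `x` ends on `n₁` instead of `y`. If `b` also ends on `y`, the two ends no
  -- longer coincide, and only the right side for `n₁` is sure to avoid interleaving.
  obtain ⟨up, hup⟩ : ∃ up, ∀ t, NextTo W₀ f (f y) t up → ∀ r p' q', N₀ x y r → N₀ b p' q' →
      ¬ Alternate (f r) t (f p') (f q') := by
    by_cases hex : ∃ r p' q', N₀ x y r ∧ N₀ b p' q'
    · obtain ⟨r, p', q', h1, h2⟩ := hex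
      have hA : ¬ Alternate (f r) (f y) (f p') (f q') := fun h =>
        hI ⟨y, r, p', q', h1, h2, h.swap_left⟩
      obtain ⟨up, hup⟩ := exists_side hA
      obtain ⟨m1, m2, -, -⟩ := C.perp₀ _ _ _ h1
      obtain ⟨m3, m4, -, -⟩ := C.perp₀ _ _ _ h2
      refine ⟨up, fun t ht r₁ p₁ q₁ e1 e2 hAlt => hup t ht.lt ht.gt ?_ ?_⟩
      · simpa using ⟨ht.near r m2, ht.near p' m3, ht.near q' m4⟩
      · have hr : r₁ = r := by
          rcases C.ends_unique _ _ _ _ _ e1 h1 with ⟨-, h⟩ | ⟨h, h'⟩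
          · exact h
          · rw [h', h]
        subst hr
        rcases C.ends_unique _ _ _ _ _ e2 h2 with ⟨rfl, rfl⟩ | ⟨rfl, rfl⟩
        · exact hAlt
        · exact hAlt.symm.swap_left.symm
    · exact ⟨true, fun t _ r p' q' h1 h2 => absurd ⟨r, p', q', h1, h2⟩ hex⟩
  -- The side of `n₂` is arbitrary, since `n₂` is moved away next.
  obtain ⟨f₁, r₁, g₁, e₁, s₁, -⟩ := C.exists_good hf.valid (.inl hf.near₂) up true
  have hfne : f x ≠ f b := fun h =>
    hbx (hf.valid x C.x_mem' b (C.mem_of_mem hb) hv h)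
  -- As a parallel of `x` and `b`, `n₂` could spoil their being adjacent or extreme. It goes outside
  -- them in the first case and between them in the second, avoiding every occupied position.
  obtain ⟨t, hts, htb⟩ := exists_position_aside hfne hbt (W.image f₁)
  have hft : Valid W (Function.update f₁ n₂ t) := g₁.valid.update fun k hk _ _ he =>
    hts (Finset.mem_image.2 ⟨k, hk, he⟩)
  have r₂ := C.symm.move₁ g₁.valid (.inl g₁.near₁) hft
  have b₂ := C.symm.noneBtw_update (t := t) g₁.near₁
  set f₂ := Function.update f₁ n₂ t with hf₂
  have e₂ : ∀ k ∈ W₀, f₂ k = f k := fun k hk => by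
    rw [hf₂, Function.update_of_ne (C.ne₂ hk), e₁ k hk]
  have hn₂ : f₂ n₂ = t := Function.update_self _ _ _
  have hn₁ : f₂ n₁ = f₁ n₁ := Function.update_of_ne n12 _ _
  have hbt₂ : NoneBtw W f₂ x b ∨ AllBtw W f₂ x b := by
    refine htb.imp (fun h k hk hkx => ?_) (fun h k hk hkx => ?_) <;>
    · rw [e₂ x C.x_mem, e₂ b hb]
      rcases (C.mem_iff k).1 hk with rfl | rfl | hk
      · exact absurd (C.n₁_vert.symm.trans hkx) C.vert_ne.symm
      · rw [hn₂]; exact h.2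
      · rw [e₂ k hk]; exact h.1 k hk hkx
  have hI₂ : ¬ Inter N f₂ x b := by
    rintro ⟨p, q, p', q', h1, h2, h3⟩
    have h2 := C.ends_b hb hbx.symm hby h2
    obtain ⟨m3, m4, -, -⟩ := C.perp₀ _ _ _ h2
    rw [e₂ p' m3, e₂ q' m4] at h3
    rcases C.ends_x _ _ h1 with ⟨rfl, h1⟩ | ⟨rfl, h1⟩
    · rw [hn₁, e₂ q (C.perp₀ _ _ _ h1).2.1] at h3
      exact hup _ s₁ q p' q' h1 h2 h3.swap_left
    · rw [hn₁, e₂ p (C.perp₀ _ _ _ h1).2.1] at h3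
      exact hup _ s₁ p p' q' h1 h2 h3
  have hsv := hft.swap C.x_mem' (C.mem_of_mem hb) hv
  have r₃ : Reach W N f₂ (f₂ ∘ Equiv.swap x b) :=
    .single ⟨hft, hsv, .inr ⟨x, C.x_mem', b, C.mem_of_mem hb, hbx, hv, hbt₂, hI₂,
      fun _ _ _ _ _ h => h⟩⟩
  have b₃ : NoneBtw W (f₂ ∘ Equiv.swap x b) n₁ y := by
    have e : ∀ k : Line, k.vert = y.vert → (f₂ ∘ Equiv.swap x b) k = f₂ k := fun k hk => by
      rw [Function.comp_apply, Equiv.swap_apply_of_ne_of_ne]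
      · rintro rfl; exact C.vert_ne hk
      · rintro rfl; exact C.vert_ne (hv.trans hk)
    intro k hk hkn
    rw [e k (hkn.trans C.n₁_vert), e _ C.n₁_vert, e y rfl]
    exact b₂ k hk hkn
  -- Throughout, `n₁` has remained next to `y`, so `n₂` is still free and can follow `x` to its new
  -- place.
  obtain ⟨g, r₄, g₄, e₄, -⟩ := C.exists_good' hsv (.inl b₃) true true
  refine ⟨g, ((r₁.trans r₂).trans r₃).trans r₄, g₄, fun k hk l hl hkl hlt => ?_⟩
  rw [e₄ k hk, e₄ l hl, Function.comp_apply, Function.comp_apply,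
    e₂ _ (swap_mem C.x_mem hb hk), e₂ _ (swap_mem C.x_mem hb hl)]
  exact hlt

/-- Since `y` is neither `a` nor `b`, the line `n₁` next to `y` lies on the same side of each of
them as `y` does, so it obstructs nothing that `y` does not. -/
theorem between_of_near (C : Corner W₀ W N₀ N x n₁ n₂ y) (hf : Good W f x n₁ n₂ y) {a b : Line}
    (ha : a ∈ W₀) (hb : b ∈ W₀) (hab : a.vert = b.vert) (hvy : a.vert = y.vert) (hay : a ≠ y)
    (hby : b ≠ y) (hbt : NoneBtw W₀ f a b ∨ AllBtw W₀ f a b) :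
    NoneBtw W f a b ∨ AllBtw W f a b := by
  have na := hf.near₁ a (C.mem_of_mem ha) (hvy.trans C.n₁_vert.symm)
  have nb := hf.near₁ b (C.mem_of_mem hb) (hab.symm.trans (hvy.trans C.n₁_vert.symm))
  have ya : f a ≠ f y := fun he => hay (hf.valid a (C.mem_of_mem ha) y C.y_mem' hvy he)
  have yb : f b ≠ f y := fun he =>
    hby (hf.valid b (C.mem_of_mem hb) y C.y_mem' (hab.symm.trans hvy) he)
  refine hbt.imp (fun h k hk hka => ?_) (fun h k hk hka => ?_)
  · rcases (C.mem_iff k).1 hk with rfl | rfl | hk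
    · have := h y C.y_mem hvy.symm
      simp only [Set.uIoo, Set.mem_Ioo, min_lt_iff, lt_max_iff] at this na nb ⊢
      grind
    · exact absurd (hka.symm.trans C.n₂_vert) (by rw [hvy]; exact C.vert_ne.symm)
    · exact h k hk hka
  · rcases (C.mem_iff k).1 hk with rfl | rfl | hk
    · have := h y C.y_mem hvy.symm
      simp only [Set.uIoo, Set.mem_Ioo, min_lt_iff, lt_max_iff] at na nb
      simp only [Set.mem_uIcc] at this ⊢
      grind
    · exact absurd (hka.symm.trans C.n₂_vert) (by rw [hvy]; exact C.vert_ne.symm)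
    · exact h k hk hka

theorem noneBtw_swap (C : Corner W₀ W N₀ N x n₁ n₂ y) (hf : Good W f x n₁ n₂ y) {a b : Line}
    (ha : a ∈ W₀) (hb : b ∈ W₀) (hab : a.vert = b.vert) (hay : a ≠ y) (hby : b ≠ y) :
    NoneBtw W (f ∘ Equiv.swap a b) n₁ y := by
  intro k hk hkn
  rw [Function.comp_apply, Function.comp_apply, Function.comp_apply,
    Equiv.swap_apply_of_ne_of_ne (C.ne₁ ha).symm (C.ne₁ hb).symm,
    Equiv.swap_apply_of_ne_of_ne hay.symm hby.symm]
  exact hf.near₁ _ (swap_mem (C.mem_of_mem ha) (C.mem_of_mem hb) hk)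
    (by rw [swap_vert hab, hkn])

/-- Lift of an exchange of edges other than `x` and `y`. -/
theorem lift_exchange_of_ne (C : Corner W₀ W N₀ N x n₁ n₂ y) (hf : Good W f x n₁ n₂ y)
    {a b : Line} (ha : a ∈ W₀) (hb : b ∈ W₀) (hab : a ≠ b) (hv : a.vert = b.vert)
    (hax : a ≠ x) (hay : a ≠ y) (hbx : b ≠ x) (hby : b ≠ y)
    (hbt : NoneBtw W₀ f a b ∨ AllBtw W₀ f a b) (hI : ¬ Inter N₀ f a b) :
    ∃ g, Reach W N f g ∧ Good W g x n₁ n₂ y ∧ OrdEq W₀ (f ∘ Equiv.swap a b) g := by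
  have hsv := hf.valid.swap (C.mem_of_mem ha) (C.mem_of_mem hb) hv
  refine ⟨f ∘ Equiv.swap a b, .single ⟨hf.valid, hsv, .inr ⟨a, C.mem_of_mem ha, b,
    C.mem_of_mem hb, hab, hv, ?_, ?_, fun _ _ _ _ _ h => h⟩⟩,
    ⟨hsv, C.noneBtw_swap hf ha hb hv hay hby, C.symm.noneBtw_swap hf.symm ha hb hv hax hbx⟩,
    fun _ _ _ _ _ h => h⟩
  · by_cases hvy : a.vert = y.vert
    · exact C.between_of_near hf ha hb hv hvy hay hby hbt
    · exact C.symm.between_of_near hf.symm ha hb hv (vert_eq_of_ne hvy C.vert_ne) hax hbx hbt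
  · rintro ⟨p, q, p', q', h1, h2, h3⟩
    exact hI ⟨p, q, p', q', C.ends_b ha hax hay h1, C.ends_b hb hbx hby h2, h3⟩

/-- An exchange move before the insertion of two lines at a corner can be carried out after it. -/
theorem lift_exchange (C : Corner W₀ W N₀ N x n₁ n₂ y) (hf : Good W f x n₁ n₂ y)
    (hE : ExAt W₀ N₀ f g) :
    ∃ h, Reach W N f h ∧ Good W h x n₁ n₂ y ∧ ∀ k ∈ W₀, h k = g k := by
  obtain ⟨a, ha, b, hb, hab, hv, hbt, hI, ho⟩ := hE
  have hf₀ : Valid W₀ f := fun k hk l hl => hf.valid k (C.mem_of_mem hk) l (C.mem_of_mem hl)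
  obtain ⟨g₁, r₁, h₁, o₁⟩ : ∃ g, Reach W N f g ∧ Good W g x n₁ n₂ y ∧
      OrdEq W₀ (f ∘ Equiv.swap a b) g := by
    have hbt' : NoneBtw W₀ f b a ∨ AllBtw W₀ f b a := hbt.imp (·.symm hv) (·.symm hv)
    by_cases hax : a = x
    · subst hax; exact C.lift_exchange_x hf hb hab hv hbt hI
    by_cases hbx : b = x
    · subst hbx
      rw [Equiv.swap_comm]
      exact C.lift_exchange_x hf ha hab.symm hv.symm hbt' fun h => hI h.symm
    by_cases hay : a = y
    · subst hay
      obtain ⟨g, h1, h2, h3⟩ := C.symm.lift_exchange_x hf.symm hb hab hv hbt hI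
      exact ⟨g, h1, h2.symm, h3⟩
    by_cases hby : b = y
    · subst hby
      obtain ⟨g, h1, h2, h3⟩ :=
        C.symm.lift_exchange_x hf.symm ha hab.symm hv.symm hbt' fun h => hI h.symm
      rw [Equiv.swap_comm]
      exact ⟨g, h1, h2.symm, h3⟩
    exact C.lift_exchange_of_ne hf ha hb hab hv hax hay hbx hby hbt hI
  -- The lift realizes only the order type of `g` on `W₀`; an isotopy then makes the positions agree
  -- exactly.
  have o₂ : OrdEq W₀ g₁ g := (o₁.symm (hf₀.swap ha hb hv)).trans ho
  obtain ⟨h, o₃, e⟩ := C.exists_extension h₁ o₂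
  exact ⟨h, r₁.trans (Reach.of_ordEq h₁.valid o₃), h₁.congr C o₃, e⟩

theorem lift_ordEq (C : Corner W₀ W N₀ N x n₁ n₂ y) (hf : Good W f x n₁ n₂ y)
    (ho : OrdEq W₀ f g) :
    ∃ h, Reach W N f h ∧ Good W h x n₁ n₂ y ∧ ∀ k ∈ W₀, h k = g k := by
  obtain ⟨h, o₃, e⟩ := C.exists_extension hf ho
  exact ⟨h, .of_ordEq hf.valid o₃, hf.congr C o₃, e⟩

end Corner

end Lifting

end RectDiagram

/-! ### Passage between diagrams and position functions -/

namespace RectDiagram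

/-- The line parallel to `a` at the position `g a`. -/
def place (g : Line → ℝ) (a : Line) : Line := ⟨a.vert, g a⟩

/-- `p` and `q` are the lines on which the edge on `a` ends. -/
def Ends (s : Cycle Line) (a p q : Line) : Prop :=
  Successive s [p, a, q] ∨ Successive s [q, a, p]

/-- Equivalence under exchange moves and isotopies. -/
def Equi : RectDiagram → RectDiagram → Prop :=
  Relation.ReflTransGen fun S T => Exchange S T ∨ SameUpToIsotopy S.edges T.edges

theorem map_congr_cycle {s : Cycle Line} {φ ψ : Line → Line} (h : ∀ a ∈ s, φ a = ψ a) :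
    s.map φ = s.map ψ := by
  induction s using Quotient.inductionOn' with
  | _ l => exact congrArg (fun l : List Line => (l : Cycle Line)) (List.map_congr_left h)

theorem map_map_cycle (s : Cycle Line) (φ ψ : Line → Line) :
    (s.map φ).map ψ = s.map (ψ ∘ φ) := by
  induction s using Quotient.inductionOn' with
  | _ l => exact congrArg (fun l : List Line => (l : Cycle Line)) List.map_map

theorem map_id_cycle (s : Cycle Line) : s.map (place Line.pos) = s := by
  induction s using Quotient.inductionOn' with
  | _ l => exact congrArg (fun l : List Line => (l : Cycle Line)) (List.map_id l)

theorem mem_map_cycle {s : Cycle Line} {φ : Line → Line} {b : Line} :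
    b ∈ s.map φ ↔ ∃ a ∈ s, φ a = b := by
  induction s using Quotient.inductionOn' with
  | _ l => exact List.mem_map

theorem mem_toFinset {s : Cycle Line} {a : Line} : a ∈ s.toFinset ↔ a ∈ s := by
  induction s using Quotient.inductionOn' with
  | _ l => exact List.mem_toFinset

theorem place_inj {s : Cycle Line} {f : Line → ℝ} (hf : Valid s.toFinset f) {a b : Line}
    (ha : a ∈ s) (hb : b ∈ s) (h : place f a = place f b) : a = b :=
  hf a (mem_toFinset.2 ha) b (mem_toFinset.2 hb) 
    (congrArg Line.vert h :) (congrArg Line.pos h :)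

theorem valid_pos (s : Cycle Line) : Valid s.toFinset Line.pos :=
  fun _ _ _ _ h h' => Line.ext h h'

theorem exists_place (D : RectDiagram) {g : Line → ℝ} (hg : Valid D.edges.toFinset g) :
    ∃ D' : RectDiagram, D'.edges = D.edges.map (place g) := by
  obtain ⟨s, h1, h2, h3⟩ := D
  simp only at hg
  refine ⟨⟨s.map (place g), ?_, ?_, ?_⟩, rfl⟩
  · induction s using Quotient.inductionOn' with
    | _ l =>
      have h1 : l.Nodup := h1
      exact h1.map_on fun a ha b hb h => place_inj hg ha hb h
  · induction s using Quotient.inductionOn' with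
    | _ l => exact (Cycle.chain_map (s := (l : Cycle Line)) (place g)).2 h2
  · induction s using Quotient.inductionOn' with
    | _ l =>
      have h3 : 4 ≤ l.length := h3
      exact h3.trans_eq (List.length_map _).symm

theorem successive_map {s : Cycle Line} {φ : Line → Line} {P A Q : Line}
    (h : Successive (s.map φ) [P, A, Q]) :
    ∃ p a q, Successive s [p, a, q] ∧ φ p = P ∧ φ a = A ∧ φ q = Q := by
  obtain ⟨l, hl⟩ := h
  induction s using Quotient.inductionOn' with
  | _ l₀ =>
    have h1 : ((l₀.map φ : List Line) : Cycle Line) = (([P, A, Q] ++ l : List Line) : Cycle Line) :=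
      hl
    obtain ⟨n, hn⟩ := Cycle.coe_eq_coe.1 h1
    rw [← List.map_rotate] at hn
    match hr : l₀.rotate n, hn with
    | p :: a :: q :: l', hn =>
      simp only [List.map_cons, List.cons_append, List.nil_append, List.cons.injEq] at hn
      refine ⟨p, a, q, ⟨l', ?_⟩, hn.1, hn.2.1, hn.2.2.1⟩
      exact Cycle.coe_eq_coe.2 ⟨n, hr⟩

theorem Successive.perp {D : RectDiagram} {p a q : Line} (h : Successive D.edges [p, a, q]) :
    p ∈ D.edges ∧ q ∈ D.edges ∧ p.vert ≠ a.vert ∧ q.vert ≠ a.vert := by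
  obtain ⟨l, hl⟩ := h
  have := D.alternating
  rw [hl] at this ⊢
  simp only [List.cons_append, List.nil_append, Cycle.chain_coe_cons, List.isChain_cons_cons]
    at this
  exact ⟨by simp, by simp, this.1, this.2.1.symm⟩

theorem perp_ends (D : RectDiagram) : Perp D.edges.toFinset (Ends D.edges) := by
  rintro a p q (h | h)
  · obtain ⟨h1, h2, h3, h4⟩ := h.perp
    exact ⟨mem_toFinset.2 h1, mem_toFinset.2 h2, h3, h4⟩
  · obtain ⟨h1, h2, h3, h4⟩ := h.perp
    exact ⟨mem_toFinset.2 h2, mem_toFinset.2 h1, h4, h3⟩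

/-- Positions of the same order type give isotopic diagrams. -/
theorem sameUpToIsotopy_of_ordEq {s : Cycle Line} {f g : Line → ℝ} (hf : Valid s.toFinset f)
    (h : OrdEq s.toFinset f g) : SameUpToIsotopy (s.map (place f)) (s.map (place g)) := by
  have : Nonempty Line := ⟨⟨true, 0⟩⟩
  have inv : ∀ a ∈ s, Function.invFunOn (place f) {a | a ∈ s} (place f a) = a := fun a ha =>
    place_inj hf (Function.invFunOn_mem (s := {a | a ∈ s}) ⟨a, ha, rfl⟩) ha
      (Function.invFunOn_eq (s := {a | a ∈ s}) ⟨a, ha, rfl⟩)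
  refine ⟨fun b => place g (Function.invFunOn (place f) {a | a ∈ s} b), ?_, ?_, ?_⟩
  · intro b hb
    obtain ⟨a, ha, rfl⟩ := mem_map_cycle.1 hb
    simp only [inv a ha]; rfl
  · intro b hb c hc hv hlt
    obtain ⟨a, ha, rfl⟩ := mem_map_cycle.1 hb
    obtain ⟨d, hd, rfl⟩ := mem_map_cycle.1 hc
    simp only [inv a ha, inv d hd]
    exact h a (mem_toFinset.2 ha) d (mem_toFinset.2 hd) hv hlt
  · rw [map_map_cycle]
    exact map_congr_cycle fun a ha => by simp only [Function.comp_apply, inv a ha]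

theorem exists_of_sameUpToIsotopy {s t : Cycle Line} (h : SameUpToIsotopy s t) :
    ∃ g, t = s.map (place g) ∧ OrdEq s.toFinset Line.pos g := by
  obtain ⟨φ, h1, h2, rfl⟩ := h
  refine ⟨fun a => (φ a).pos, map_congr_cycle fun a ha => Line.ext (h1 a ha) rfl, ?_⟩
  intro a ha b hb
  exact h2 a (mem_toFinset.1 ha) b (mem_toFinset.1 hb)

/-- The converse of `exchange_of_exAt` with the lines of `S` themselves as labels: `T` is written as
the same cyclic sequence with new positions. `Ends` forgets the orientation, which is harmless
because alternation ignores the order of the ends. -/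
theorem exists_of_exchange {S T : RectDiagram} (h : Exchange S T) :
    ∃ g, T.edges = S.edges.map (place g) ∧ ExAt S.edges.toFinset (Ends S.edges) Line.pos g := by
  obtain ⟨a, ha, b, hb, hab, hv, hbt, hI, φ, h1, h2, h3⟩ := h
  have hm : ∀ k ∈ S.edges, Equiv.swap a b k ∈ S.edges := fun k hk =>
    mem_toFinset.1 (swap_mem (mem_toFinset.2 ha) (mem_toFinset.2 hb) (mem_toFinset.2 hk))
  have hm' : ∀ k ∈ S.edges, Equiv.swap a b k ∈ S.edges.map (Equiv.swap a b) := fun k hk =>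
    mem_map_cycle.2 ⟨k, hk, rfl⟩
  refine ⟨fun k => (φ (Equiv.swap a b k)).pos, ?_, a, mem_toFinset.2 ha, b, mem_toFinset.2 hb,
    hab, hv, ?_, ?_, ?_⟩
  · rw [← h3, map_map_cycle]
    exact map_congr_cycle fun k hk => Line.ext ((h1 _ (hm' k hk)).trans (swap_vert hv k)) rfl
  · exact hbt.imp (fun h k hk => h k (mem_toFinset.1 hk)) (fun h k hk => h k (mem_toFinset.1 hk))
  · rintro ⟨p, n, p', n', e1, e2, e3⟩
    rcases e1 with e1 | e1 <;> rcases e2 with e2 | e2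
    · exact hI ⟨_, _, _, _, e1, e2, e3⟩
    · exact hI ⟨_, _, _, _, e1, e2, e3.symm.swap_left.symm⟩
    · exact hI ⟨_, _, _, _, e1, e2, e3.swap_left⟩
    · exact hI ⟨_, _, _, _, e1, e2, e3.swap_left.symm.swap_left.symm⟩
  · intro k hk l hl hkl hlt
    exact h2 _ (hm' k (mem_toFinset.1 hk)) _ (hm' l (mem_toFinset.1 hl))
      (by rw [swap_vert hv, swap_vert hv, hkl]) hlt

theorem exchange_of_exAt {D S T : RectDiagram} {f g : Line → ℝ}
    (hf : Valid D.edges.toFinset f) (hS : S.edges = D.edges.map (place f))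
    (hT : T.edges = D.edges.map (place g)) (h : ExAt D.edges.toFinset (Ends D.edges) f g) :
    Exchange S T := by
  obtain ⟨a, ha, b, hb, hab, hv, hbt, hI, ho⟩ := h
  have hsv := hf.swap ha hb hv
  have hswap : ∀ k ∈ D.edges, Equiv.swap (place f a) (place f b) (place f k) =
      place (f ∘ Equiv.swap a b) k := by
    intro k hk
    have e : place (f ∘ Equiv.swap a b) k = place f (Equiv.swap a b k) :=
      Line.ext (swap_vert hv k).symm rfl
    rw [e]
    by_cases h1 : k = a
    · subst h1; rw [Equiv.swap_apply_left, Equiv.swap_apply_left]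
    by_cases h2 : k = b
    · subst h2; rw [Equiv.swap_apply_right, Equiv.swap_apply_right]
    rw [Equiv.swap_apply_of_ne_of_ne h1 h2, Equiv.swap_apply_of_ne_of_ne]
    · exact fun h => h1 (place_inj hf hk (mem_toFinset.1 ha) h)
    · exact fun h => h2 (place_inj hf hk (mem_toFinset.1 hb) h)
  rw [mem_toFinset] at ha hb
  refine ⟨place f a, ?_, place f b, ?_, fun h => hab (place_inj hf ha hb h), hv, ?_, ?_, ?_⟩
  · rw [hS]; exact mem_map_cycle.2 ⟨a, ha, rfl⟩
  · rw [hS]; exact mem_map_cycle.2 ⟨b, hb, rfl⟩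
  · rw [hS]
    refine hbt.imp (fun h k hk hka => ?_) (fun h k hk hka => ?_) <;>
    · obtain ⟨k, hk', rfl⟩ := mem_map_cycle.1 hk
      exact h k (mem_toFinset.2 hk') hka
  · rintro ⟨p, n, p', n', e1, e2, e3⟩
    rw [hS] at e1 e2
    obtain ⟨p, a', n, c1, rfl, h1, rfl⟩ := successive_map e1
    obtain ⟨p', b', n', c2, rfl, h2, rfl⟩ := successive_map e2
    have ha' : a' ∈ D.edges := by
      obtain ⟨l, hl⟩ := c1; rw [hl]; simp
    have hb' : b' ∈ D.edges := by
      obtain ⟨l, hl⟩ := c2; rw [hl]; simp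
    obtain rfl := place_inj hf ha' ha h1
    obtain rfl := place_inj hf hb' hb h2
    exact hI ⟨p, n, p', n', .inl c1, .inl c2, e3⟩
  · rw [hS, hT, map_map_cycle, map_congr_cycle (φ := _ ∘ _) hswap]
    exact sameUpToIsotopy_of_ordEq hsv ho

theorem equi_of_reach {D : RectDiagram} {f g : Line → ℝ}
    (h : Reach D.edges.toFinset (Ends D.edges) f g) (hf : Valid D.edges.toFinset f)
    {S T : RectDiagram} (hS : S.edges = D.edges.map (place f))
    (hT : T.edges = D.edges.map (place g)) : Equi S T := by
  induction h generalizing T with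
  | refl => exact .single (.inr (hS ▸ hT ▸ sameUpToIsotopy_of_ordEq hf fun _ _ _ _ _ h => h))
  | tail h1 h2 ih =>
    obtain ⟨U, hU⟩ := exists_place D h2.1
    refine (ih hU).tail ?_
    rcases h2.2.2 with h | h
    · right
      rw [hU, hT]
      exact sameUpToIsotopy_of_ordEq h2.1 h
    · exact .inl (exchange_of_exAt h2.1 hU hT h)

theorem equi_of_reach_pos {D T : RectDiagram} {g : Line → ℝ}
    (h : Reach D.edges.toFinset (Ends D.edges) Line.pos g)
    (hT : T.edges = D.edges.map (place g)) : Equi D T :=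
  equi_of_reach h (valid_pos _) (map_id_cycle _).symm hT

/-- An exchange move or isotopy comes from a step on positions. -/
theorem exists_step {S T : RectDiagram} (h : Exchange S T ∨ SameUpToIsotopy S.edges T.edges) :
    ∃ g, T.edges = S.edges.map (place g) ∧
      (OrdEq S.edges.toFinset Line.pos g ∨ ExAt S.edges.toFinset (Ends S.edges) Line.pos g) := by
  rcases h with h | h
  · obtain ⟨g, h1, h2⟩ := exists_of_exchange h
    exact ⟨g, h1, .inr h2⟩
  · obtain ⟨g, h1, h2⟩ := exists_of_sameUpToIsotopy h
    exact ⟨g, h1, .inl h2⟩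

/-- This reversibility is what allows two diagrams to be compared through a common ancestor. -/
theorem Equi.symm {S T : RectDiagram} (h : Equi S T) : Equi T S := by
  induction h with
  | refl => exact .refl
  | @tail U T _ h2 ih =>
    refine .head ?_ ih
    obtain ⟨g, h1, h2⟩ := exists_step h2
    have hv := valid_pos U.edges
    rcases h2 with h2 | h2
    · right
      have := sameUpToIsotopy_of_ordEq (h2.valid hv) (h2.symm hv)
      rwa [map_id_cycle, ← h1] at this
    · exact .inl (exchange_of_exAt (h2.valid hv) h1 (map_id_cycle _).symm
        (h2.symm (perp_ends U) hv))

theorem SameUpToIsotopy.trans {s t u : Cycle Line} (h₁ : SameUpToIsotopy s t)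
    (h₂ : SameUpToIsotopy t u) : SameUpToIsotopy s u := by
  obtain ⟨φ, a1, a2, rfl⟩ := h₁
  obtain ⟨ψ, b1, b2, rfl⟩ := h₂
  refine ⟨ψ ∘ φ, fun a ha => ?_, fun a ha b hb hv hlt => ?_, (map_map_cycle _ _ _).symm⟩
  · exact (b1 _ (mem_map_cycle.2 ⟨a, ha, rfl⟩)).trans (a1 a ha)
  · exact b2 _ (mem_map_cycle.2 ⟨a, ha, rfl⟩) _ (mem_map_cycle.2 ⟨b, hb, rfl⟩)
      (by rw [a1 a ha, a1 b hb, hv]) (a2 a ha b hb hv hlt)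

theorem sameUpToIsotopy_refl (s : Cycle Line) : SameUpToIsotopy s s :=
  ⟨place Line.pos, fun _ _ => rfl, fun _ _ _ _ _ h => h, map_id_cycle s⟩

theorem SameUpToIsotopy.symm {s t : Cycle Line} (h : SameUpToIsotopy s t) :
    SameUpToIsotopy t s := by
  obtain ⟨g, rfl, h2⟩ := exists_of_sameUpToIsotopy h
  have hv := valid_pos s
  have := sameUpToIsotopy_of_ordEq (h2.valid hv) (h2.symm hv)
  rwa [map_id_cycle] at this

/-- Isotopies can be postponed. -/
theorem Equi.exists_exchanges {S T : RectDiagram} (h : Equi S T) :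
    ∃ T', Relation.ReflTransGen Exchange S T' ∧ SameUpToIsotopy T.edges T'.edges := by
  induction h with
  | refl => exact ⟨S, .refl, sameUpToIsotopy_refl _⟩
  | @tail U V _ h2 ih =>
    obtain ⟨T', h3, h4⟩ := ih
    rcases h2 with h2 | h2
    · obtain ⟨g, e1, e2⟩ := exists_of_exchange h2
      obtain ⟨f, e3, e4⟩ := exists_of_sameUpToIsotopy h4
      have hv := valid_pos U.edges
      -- The final positions of an exchange matter only up to isotopy. Reading the move backwards
      -- puts the isotopy from `U` to `T'` at its end, where it is absorbed by `ho.trans e4`;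
      -- reversing again gives an exchange from `T'` to `V`.
      obtain ⟨a, ha, b, hb, hab, hv', hbt, hI, ho⟩ := e2.symm (perp_ends U) hv
      refine ⟨V, h3.tail ?_, sameUpToIsotopy_refl _⟩
      refine exchange_of_exAt (D := U) (e4.valid hv) e3 e1
        (ExAt.symm (perp_ends U) (e2.valid hv) ⟨a, ha, b, hb, hab, hv', hbt, hI, ho.trans e4⟩)
    · exact ⟨T', h3, h2.symm.trans h4⟩

end RectDiagram

/-! ### Insertions at corners of diagrams; merges as inverse insertions -/

namespace RectDiagram

/-- Without repetitions, a rotation that keeps the first entry is trivial. Cutting a cyclic sequence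
open at a given line is thus unambiguous, which makes the neighbours of an edge unique. -/
theorem eq_of_isRotated_cons {a : Line} {u v : List Line} (hn : (a :: u).Nodup)
    (h : (a :: u) ~r (a :: v)) : u = v := by
  obtain ⟨n, hn'⟩ := h
  rw [← List.rotate_mod] at hn'
  set m := n % (a :: u).length with hm
  have hlt : m < (a :: u).length := Nat.mod_lt _ (by simp)
  have h0 : ((a :: u).rotate m)[0]'(by simp) = a := by simp [hn']
  rw [List.getElem_rotate] at h0
  have hm0 : m = 0 := by
    have h1 : (a :: u)[(0 + m) % (a :: u).length]'(Nat.mod_lt _ (by simp)) =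
        (a :: u)[0]'(by simp) := by rw [h0]; rfl
    have := (List.Nodup.getElem_inj_iff hn).1 h1
    rwa [zero_add, Nat.mod_eq_of_lt hlt] at this
  rw [hm0, List.rotate_zero] at hn'
  exact (List.cons.inj hn').2

theorem coe_append_comm (A B : List Line) :
    ((A ++ B : List Line) : Cycle Line) = ((B ++ A : List Line) : Cycle Line) :=
  Cycle.coe_eq_coe.2 List.isRotated_append

theorem successive_of_append (A w B : List Line) :
    Successive ((A ++ w ++ B : List Line) : Cycle Line) w :=
  ⟨B ++ A, by rw [List.append_assoc, coe_append_comm, List.append_assoc]⟩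

theorem successive_unique {s : Cycle Line} (hs : s.Nodup) {p a q p' q' : Line}
    (h : Successive s [p, a, q]) (h' : Successive s [p', a, q']) : p = p' ∧ q = q' := by
  obtain ⟨l, rfl⟩ := h
  obtain ⟨l', hl'⟩ := h'
  have e : ∀ (p q : Line) (l : List Line), (([p, a, q] ++ l : List Line) : Cycle Line) =
      ((a :: (q :: l ++ [p]) : List Line) : Cycle Line) := fun p q l =>
    coe_append_comm [p] (a :: q :: l)
  rw [e p q l] at hs hl'
  rw [e p' q' l'] at hl'
  have := eq_of_isRotated_cons (Cycle.nodup_coe_iff.1 hs) (Cycle.coe_eq_coe.1 hl')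
  rw [List.cons_append, List.cons_append, List.cons.injEq] at this
  have h2 := List.append_inj' this.2 rfl
  exact ⟨(List.cons.inj h2.2).1, this.1⟩

theorem ends_unique {s : Cycle Line} (hs : s.Nodup) {p a q p' q' : Line}
    (h : Ends s a p q) (h' : Ends s a p' q') : (p = p' ∧ q = q') ∨ (p = q' ∧ q = p') := by
  rcases h with h | h <;> rcases h' with h' | h' <;> have := successive_unique hs h h' <;> tauto

/-- `U` is obtained from `R` by inserting at a corner two lines which are next to the lines
of this corner. -/
def Inserted (R U : RectDiagram) : Prop :=
  ∃ (x n₁ n₂ y : Line) (l : List Line), R.edges = ((x :: y :: l : List Line) : Cycle Line) ∧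
    U.edges = ((x :: n₁ :: n₂ :: y :: l : List Line) : Cycle Line) ∧
    NoneBetween U.edges n₁ y ∧ NoneBetween U.edges n₂ x

theorem corner_of_edges {R U : RectDiagram} {x n₁ n₂ y : Line} {l : List Line}
    (hR : R.edges = ((x :: y :: l : List Line) : Cycle Line))
    (hU : U.edges = ((x :: n₁ :: n₂ :: y :: l : List Line) : Cycle Line)) :
    Corner R.edges.toFinset U.edges.toFinset (Ends R.edges) (Ends U.edges) x n₁ n₂ y := by
  have nR := R.nodup
  have nU := U.nodup
  have aU := U.alternating
  have aR := R.alternating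
  have lR := R.four_le_length
  have nU' := nU
  rw [hU, Cycle.nodup_coe_iff] at nU'
  rw [hU] at aU
  rw [hR] at aR lR
  simp only [Cycle.chain_coe_cons, List.cons_append, List.isChain_cons_cons] at aU aR
  simp only [Cycle.length_coe, List.length_cons] at lR
  simp only [List.nodup_cons, List.mem_cons, not_or] at nU'
  have sU : ∀ (A w B : List Line), x :: n₁ :: n₂ :: y :: l = A ++ w ++ B → Successive U.edges w :=
    fun A w B h => by rw [hU, h]; exact successive_of_append A w B
  have s1 := sU [] [x, n₁, n₂] (y :: l) rfl
  have s2 := sU [x] [n₁, n₂, y] l rfl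
  -- As `R` has at least four edges, `l` is nonempty: its first entry is the other neighbour of `y`,
  -- its last entry that of `x`.
  obtain ⟨z', l', rfl⟩ : ∃ z' l', l = z' :: l' := by
    cases l with
    | nil => simp at lR
    | cons z' l' => exact ⟨z', l', rfl⟩
  have s3 := sU [x, n₁] [n₂, y, z'] l' rfl
  have t3 : Successive R.edges [x, y, z'] := by
    rw [hR]; exact successive_of_append [] [x, y, z'] l'
  obtain ⟨l'', z, hz⟩ : ∃ l'' z, z' :: l' = l'' ++ [z] :=
    ⟨_, _, (List.dropLast_append_getLast (List.cons_ne_nil _ _)).symm⟩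
  have s4 : Successive U.edges [z, x, n₁] := by
    rw [hU, hz]
    exact ⟨_, coe_append_comm (x :: n₁ :: n₂ :: y :: l'') [z]⟩
  have t4 : Successive R.edges [z, x, y] := by
    rw [hR, hz]
    exact ⟨_, coe_append_comm (x :: y :: l'') [z]⟩
  refine ⟨?_, ?_, ?_, ?_, ?_, ?_, ?_, ?_, perp_ends U, perp_ends R, ?_, ?_, ?_, ?_, ?_, ?_⟩
  · intro k
    rw [mem_toFinset, mem_toFinset, hU, hR, Cycle.mem_coe_iff, Cycle.mem_coe_iff]
    simp only [List.mem_cons]; tauto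
  · rw [mem_toFinset, hR]; simp
  · rw [mem_toFinset, hR]; simp
  · rw [mem_toFinset, hR]
    simp only [Cycle.mem_coe_iff, List.mem_cons, not_or]
    exact ⟨fun h => nU'.1.1 h.symm, by simpa using nU'.2.1.2⟩
  · rw [mem_toFinset, hR]
    simp only [Cycle.mem_coe_iff, List.mem_cons, not_or]
    exact ⟨fun h => nU'.1.2.1 h.symm, by simpa using nU'.2.2.1⟩
  · exact vert_eq_of_ne aU.2.1 aU.2.2.1.symm
  · exact vert_eq_of_ne aU.2.1.symm aU.1
  · exact aR.1
  · rintro p q (h | h) <;> have := successive_unique nU h s1 <;> tauto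
  · rintro p q (h | h) <;> have := successive_unique nU h s2 <;> tauto
  · rintro p q (h | h) <;> have := successive_unique nU h s4
    · right; rw [this.1, this.2]; exact ⟨rfl, .inr t4⟩
    · left; rw [this.1, this.2]; exact ⟨rfl, .inr t4⟩
  · rintro p q (h | h) <;> have := successive_unique nU h s3
    · left; rw [this.1, this.2]; exact ⟨rfl, .inl t3⟩
    · right; rw [this.1, this.2]; exact ⟨rfl, .inl t3⟩
  · have key : ∀ a p q, a ≠ x → a ≠ n₁ → a ≠ n₂ → a ≠ y → Successive U.edges [p, a, q] →
        Successive R.edges [p, a, q] := by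
      intro a p q h1 h2 h3 h4 h
      have ha : a ∈ U.edges := by obtain ⟨l, hl⟩ := h; rw [hl]; simp
      rw [hU] at ha
      simp only [Cycle.mem_coe_iff, List.mem_cons, h1, h2, h3, h4, false_or] at ha
      rw [← List.mem_cons] at ha
      obtain ⟨u, v, huv⟩ := List.append_of_mem ha
      rw [huv] at hU hR
      -- The stretch from `y` through `l` to `x` occurs in both cyclic sequences, and it contains
      -- `a` with both its neighbours.
      obtain ⟨A, p₀, hA⟩ : ∃ A p₀, y :: u = A ++ [p₀] :=
        ⟨_, _, (List.dropLast_append_getLast (List.cons_ne_nil _ _)).symm⟩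
      obtain ⟨q₀, B, hB⟩ : ∃ q₀ B, v ++ [x] = q₀ :: B := by
        cases v with
        | nil => exact ⟨_, _, rfl⟩
        | cons q₀ v => exact ⟨_, _, rfl⟩
      have e1 : U.edges = ((([n₁, n₂] ++ A) ++ [p₀, a, q₀] ++ B : List Line) : Cycle Line) := by
        have : [n₁, n₂] ++ A ++ [p₀, a, q₀] ++ B = n₁ :: n₂ :: ((y :: u) ++ (a :: (v ++ [x]))) := by
          rw [hA, hB]; simp
        rw [hU, this]
        exact (coe_append_comm [x] (n₁ :: n₂ :: y :: (u ++ a :: v))).trans (by simp)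
      have e2 : R.edges = ((A ++ [p₀, a, q₀] ++ B : List Line) : Cycle Line) := by
        have : A ++ [p₀, a, q₀] ++ B = ((y :: u) ++ (a :: (v ++ [x]))) := by
          rw [hA, hB]; simp
        rw [hR, this]
        exact (coe_append_comm [x] (y :: (u ++ a :: v))).trans (by simp)
      have h5 : Successive U.edges [p₀, a, q₀] := e1 ▸ successive_of_append _ _ _
      obtain ⟨rfl, rfl⟩ := successive_unique nU h h5
      exact e2 ▸ successive_of_append _ _ _
    intro a p q h1 h2 h3 h4 h
    exact h.imp (key a p q h1 h2 h3 h4) (key a q p h1 h2 h3 h4)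
  · exact fun a p q p' q' h h' => ends_unique nR h h'

theorem NoneBetween.noneBtw {s : Cycle Line} {a b : Line} (h : NoneBetween s a b) :
    NoneBtw s.toFinset Line.pos a b := fun k hk => h k (mem_toFinset.1 hk)

theorem AllBetween.allBtw {s : Cycle Line} {a b : Line} (h : AllBetween s a b) :
    AllBtw s.toFinset Line.pos a b := fun k hk => h k (mem_toFinset.1 hk)

theorem NoneBtw.noneBetween {s : Cycle Line} {g : Line → ℝ} {a b : Line}
    (h : NoneBtw s.toFinset g a b) : NoneBetween (s.map (place g)) (place g a) (place g b) := by
  intro k hk hka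
  obtain ⟨k, hk', rfl⟩ := mem_map_cycle.1 hk
  exact h k (mem_toFinset.2 hk') hka

/-- A move can be carried out after an insertion instead of before. -/
theorem Inserted.lift_step {R R' U : RectDiagram} (h : Inserted R U)
    (hR : Exchange R R' ∨ SameUpToIsotopy R.edges R'.edges) :
    ∃ U', Equi U U' ∧ Inserted R' U' := by
  obtain ⟨x, n₁, n₂, y, l, h1, h2, h3, h4⟩ := h
  have C := corner_of_edges h1 h2
  have hG : Good U.edges.toFinset Line.pos x n₁ n₂ y := ⟨valid_pos _, h3.noneBtw, h4.noneBtw⟩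
  obtain ⟨g, e1, e2⟩ := exists_step hR
  obtain ⟨f, r, hf, hfg⟩ : ∃ h, Reach U.edges.toFinset (Ends U.edges) Line.pos h ∧
      Good U.edges.toFinset h x n₁ n₂ y ∧ ∀ k ∈ R.edges.toFinset, h k = g k := by
    rcases e2 with e2 | e2
    · exact C.lift_ordEq hG e2
    · exact C.lift_exchange hG e2
  obtain ⟨U', hU'⟩ := exists_place U hf.valid
  refine ⟨U', equi_of_reach_pos r hU', place f x, place f n₁, place f n₂, place f y,
    l.map (place f), ?_, ?_, ?_, ?_⟩
  · rw [e1, map_congr_cycle (φ := place g) (ψ := place f), h1]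
    · rfl
    · exact fun a ha => Line.ext rfl (hfg a (mem_toFinset.2 ha)).symm
  · rw [hU', h2]; rfl
  · rw [hU']; exact hf.near₁.noneBetween
  · rw [hU']; exact hf.near₂.noneBetween

theorem Inserted.lift {R R' U : RectDiagram} (h : Inserted R U) (hR : Equi R R') :
    ∃ U', Equi U U' ∧ Inserted R' U' := by
  induction hR with
  | refl => exact ⟨U, .refl, h⟩
  | tail _ h2 ih =>
    obtain ⟨U₁, e1, i1⟩ := ih
    obtain ⟨U₂, e2, i2⟩ := i1.lift_step h2
    exact ⟨U₂, e1.trans e2, i2⟩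

/-- If only the inserted lines move, the result is literally an insertion into the same `R`, with no
isotopy in between. -/
theorem exists_place_corner {R U : RectDiagram} {x n₁ n₂ y : Line} {l : List Line}
    (h1 : R.edges = ((x :: y :: l : List Line) : Cycle Line))
    (h2 : U.edges = ((x :: n₁ :: n₂ :: y :: l : List Line) : Cycle Line)) {g : Line → ℝ}
    (hg : Valid U.edges.toFinset g) (hr : ∀ k ∈ R.edges.toFinset, g k = k.pos) :
    ∃ U' : RectDiagram, U'.edges = U.edges.map (place g) ∧
      U'.edges = ((x :: place g n₁ :: place g n₂ :: y :: l : List Line) : Cycle Line) := by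
  obtain ⟨U', hU'⟩ := exists_place U hg
  refine ⟨U', hU', ?_⟩
  have e : ∀ k ∈ x :: y :: l, place g k = k := fun k hk =>
    Line.ext rfl (hr k (mem_toFinset.2 (by rw [h1]; exact hk)))
  rw [hU', h2]
  have e1 : place g x = x := e x (by simp)
  have e2 : place g y = y := e y (by simp)
  have e3 : l.map (place g) = l := by
    rw [List.map_congr_left (g := id) fun k hk => e k (by simp [hk]), List.map_id]
  change ((place g x :: place g n₁ :: place g n₂ :: place g y :: l.map (place g) : List Line) :
    Cycle Line) = _
  rw [e1, e2, e3]

/-- The inserted lines may be placed on any side of the lines of the corner. -/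
theorem Inserted.exists_sides {R U : RectDiagram} (h : Inserted R U) :
    ∃ (x y : Line) (l : List Line), R.edges = ((x :: y :: l : List Line) : Cycle Line) ∧
      ∀ up₁ up₂ : Bool, ∃ (n₁ n₂ : Line) (U' : RectDiagram), Equi U U' ∧
        U'.edges = ((x :: n₁ :: n₂ :: y :: l : List Line) : Cycle Line) ∧
        n₁.vert = y.vert ∧ n₂.vert = x.vert ∧
        NextTo R.edges.toFinset Line.pos y.pos n₁.pos up₁ ∧
        NextTo R.edges.toFinset Line.pos x.pos n₂.pos up₂ := by
  obtain ⟨x, n₁, n₂, y, l, h1, h2, h3, h4⟩ := h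
  have C := corner_of_edges h1 h2
  refine ⟨x, y, l, h1, fun up₁ up₂ => ?_⟩
  obtain ⟨g, r, hG, e, s1, s2⟩ := C.exists_good (valid_pos _) (.inl h4.noneBtw) up₁ up₂
  obtain ⟨U', hU', hU''⟩ := exists_place_corner h1 h2 hG.valid e
  exact ⟨_, _, U', equi_of_reach_pos r hU', hU'', C.n₁_vert, C.n₂_vert, s1, s2⟩

theorem exists_inserted {R U : RectDiagram} {x n₁ n₂ y : Line} {l : List Line}
    (h1 : R.edges = ((x :: y :: l : List Line) : Cycle Line))
    (h2 : U.edges = ((x :: n₁ :: n₂ :: y :: l : List Line) : Cycle Line))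
    (h : (NoneBetween U.edges n₂ x ∨ AllBetween U.edges n₂ x) ∨
      (NoneBetween U.edges n₁ y ∨ AllBetween U.edges n₁ y)) :
    ∃ U', Equi U U' ∧ Inserted R U' := by
  have C := corner_of_edges h1 h2
  obtain ⟨g, r, hG, e⟩ : ∃ g, Reach U.edges.toFinset (Ends U.edges) Line.pos g ∧
      Good U.edges.toFinset g x n₁ n₂ y ∧ ∀ k ∈ R.edges.toFinset, g k = k.pos := by
    rcases h with h | h
    · obtain ⟨g, r, hG, e, -⟩ := C.exists_good (valid_pos _) (h.imp (·.noneBtw) (·.allBtw)) true true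
      exact ⟨g, r, hG, e⟩
    · obtain ⟨g, r, hG, e, -⟩ :=
        C.exists_good' (valid_pos _) (h.imp (·.noneBtw) (·.allBtw)) true true
      exact ⟨g, r, hG, e⟩
  obtain ⟨U', hU', hU''⟩ := exists_place_corner h1 h2 hG.valid e
  have hRx : place g x = x := Line.ext rfl (e x C.x_mem)
  have hRy : place g y = y := Line.ext rfl (e y C.y_mem)
  refine ⟨U', equi_of_reach_pos r hU', x, place g n₁, place g n₂, y, l, h1, hU'', ?_, ?_⟩
  · rw [hU', ← hRy]; exact hRy.symm ▸ hG.near₁.noneBetween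
  · rw [hU', ← hRx]; exact hRx.symm ▸ hG.near₂.noneBetween

theorem exists_removed {U : RectDiagram} {x n₁ n₂ y : Line} {l : List Line}
    (h : U.edges = ((x :: n₁ :: n₂ :: y :: l : List Line) : Cycle Line)) (hl : 2 ≤ l.length) :
    ∃ R : RectDiagram, R.edges = ((x :: y :: l : List Line) : Cycle Line) := by
  have n := U.nodup
  have a := U.alternating
  rw [h] at n a
  rw [Cycle.nodup_coe_iff] at n
  refine ⟨⟨((x :: y :: l : List Line) : Cycle Line), ?_, ?_, ?_⟩, rfl⟩
  · rw [Cycle.nodup_coe_iff]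
    exact n.sublist (.cons_cons _ (.cons _ (.cons _ (.refl _))))
  · simp only [Cycle.chain_coe_cons, List.cons_append, List.isChain_cons_cons] at a ⊢
    refine ⟨?_, a.2.2.2⟩
    rw [vert_eq_of_ne a.1 a.2.1.symm]
    exact a.2.2.1
  · simpa using hl

/-- When the merged edge keeps the position of `e`, the pair `f`, `g` is inserted between `e` and
the edge after `g`; when it keeps that of `g`, the pair `e`, `f` is inserted between the edge before
`e` and `g`. In both cases the hypothesis on `e` and `g` frees one of the inserted edges. -/
theorem Merge.exists_inserted {S S' : RectDiagram} (h : Merge S S') :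
    ∃ U, Equi S U ∧ Inserted S' U := by
  obtain ⟨e, f, g, l, h1, h2, h3⟩ := h
  -- The merged diagram has at least four edges, so at least three remain besides the amalgamated
  -- one.
  have hlen : ∀ {a : Line}, SameUpToIsotopy ((a :: l : List Line) : Cycle Line) S'.edges →
      3 ≤ l.length := by
    rintro a ⟨φ, -, -, hφ⟩
    have := S'.four_le_length
    rw [← hφ] at this
    change 4 ≤ ((a :: l).map φ).length at this
    simp at this
    omega
  rcases h3 with h3 | h3
  · have hl := hlen h3
    match l, hl with
    | y :: l, hl =>
      obtain ⟨R, hR⟩ := exists_removed h1 (Nat.le_of_succ_le_succ hl)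
      have he : e.vert = g.vert := by
        have a := S.alternating
        rw [h1] at a
        simp only [Cycle.chain_coe_cons, List.cons_append, List.isChain_cons_cons] at a
        exact vert_eq_of_ne a.1 a.2.1.symm
      obtain ⟨U, hU, hI⟩ := RectDiagram.exists_inserted hR h1 (.inl (h2.imp
        (fun h k hk hkg => by rw [Set.uIoo_comm]; exact h k hk (hkg.trans he.symm))
        (fun h k hk hkg => by rw [Set.uIcc_comm]; exact h k hk (hkg.trans he.symm))))
      obtain ⟨U', hU', hI'⟩ := hI.lift_step (R' := S') (.inr (hR ▸ h3))
      exact ⟨U', hU.trans hU', hI'⟩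
  · have hl := hlen h3
    obtain ⟨l', d, rfl⟩ : ∃ l' d, l = l' ++ [d] :=
      ⟨_, _, (List.dropLast_append_getLast
        (List.length_pos_iff.1 (lt_of_lt_of_le (by norm_num) hl))).symm⟩
    have h1' : S.edges = ((d :: e :: f :: g :: l' : List Line) : Cycle Line) :=
      h1.trans (coe_append_comm (e :: f :: g :: l') [d])
    obtain ⟨R, hR⟩ := exists_removed h1' (by simpa using hl)
    obtain ⟨U, hU, hI⟩ := RectDiagram.exists_inserted hR h1' (.inr h2)
    obtain ⟨U', hU', hI'⟩ := hI.lift_step (R' := S') (.inr (by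
      rw [hR]
      exact (coe_append_comm (g :: l') [d]) ▸ h3))
    exact ⟨U', hU.trans hU', hI'⟩

end RectDiagram

/-! ### Outlines: invariance under isotopy, and monotone sequences of short edges -/

namespace RectDiagram

theorem isOutline_refl (S : RectDiagram) : IsOutline S S := by
  obtain ⟨l, hl⟩ := Quotient.exists_rep S.edges
  refine ⟨id, id, fun _ => [], ⟨l, hl.symm, ?_⟩, fun _ _ => rfl, fun _ _ _ _ _ h => h, ?_⟩
  · rw [← hl]
    simp only [notchedEdge, List.flatMap_nil, id, List.flatMap_singleton']
    rfl
  · intro c d e g _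
    simp

theorem SameDirection.map {u v a b a' b' : Line} (h : SameDirection u v a b)
    (h1 : a.pos < b.pos → a'.pos < b'.pos) (h2 : b.pos < a.pos → b'.pos < a'.pos) :
    SameDirection u v a' b' :=
  h.imp (And.imp_right h1) (And.imp_right h2)

theorem map_flatMap_notchedEdge (φ : Line → Line) (long : Line → Line)
    (notches : Line → List (Line × Line)) (l : List Line) :
    (l.flatMap fun e => notchedEdge (long e) (notches e)).map φ =
      l.flatMap fun e => notchedEdge (φ (long e)) ((notches e).map (Prod.map φ φ)) := by
  simp [List.map_flatMap, notchedEdge, List.flatMap_map]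

theorem mem_notchedEdge {a b : Line} {n : List (Line × Line)} :
    a ∈ notchedEdge b n ↔ a = b ∨ ∃ z ∈ n, a = z.1 ∨ a = z.2 := by
  simp [notchedEdge]

theorem successive_mem {s : Cycle Line} {w : List Line} (h : Successive s w) {a : Line}
    (ha : a ∈ w) : a ∈ s := by
  obtain ⟨l, rfl⟩ := h
  exact Cycle.mem_coe_iff.2 (List.mem_append_left _ ha)

theorem successive_left {s : Cycle Line} {a b c d : Line} (h : Successive s [a, b, c, d]) :
    Successive s [a, b, c] := by
  obtain ⟨l, rfl⟩ := h
  exact ⟨d :: l, rfl⟩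

theorem successive_right {s : Cycle Line} {a b c d : Line} (h : Successive s [a, b, c, d]) :
    Successive s [b, c, d] := by
  obtain ⟨l, rfl⟩ := h
  exact successive_of_append [a] [b, c, d] l

theorem exists_successive (S : RectDiagram) {e : Line} (he : e ∈ S.edges) :
    ∃ c d g, Successive S.edges [c, d, e, g] := by
  have h4 := S.four_le_length
  induction hs : S.edges using Quotient.inductionOn' with
  | _ l =>
    rw [hs] at he h4
    have he : e ∈ l := he
    have h4 : 4 ≤ l.length := h4
    obtain ⟨A, B, rfl⟩ := List.append_of_mem he
    have e1 : Quotient.mk'' (A ++ e :: B) = ((e :: (B ++ A) : List Line) : Cycle Line) :=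
      coe_append_comm A (e :: B)
    have h5 : 3 ≤ (B ++ A).length := by simp at h4 ⊢; omega
    rw [e1]
    generalize B ++ A = m at h5
    match m, h5 with
    | g :: m, h5 =>
      obtain ⟨m', d, rfl⟩ : ∃ m' d, m = m' ++ [d] :=
        ⟨_, _, (List.dropLast_append_getLast
          (List.length_pos_iff.1 (by simp at h5; omega))).symm⟩
      obtain ⟨m'', c, rfl⟩ : ∃ m'' c, m' = m'' ++ [c] :=
        ⟨_, _, (List.dropLast_append_getLast
          (List.length_pos_iff.1 (by simp at h5; omega))).symm⟩
      refine ⟨c, d, g, m'', ?_⟩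
      have := coe_append_comm (e :: g :: m'') [c, d]
      simpa using this

/-- Being an outline is invariant under isotopies of the second diagram. -/
theorem IsOutline.of_sameUpToIsotopy {S T T' : RectDiagram} (h : IsOutline S T)
    (hT : SameUpToIsotopy T.edges T'.edges) : IsOutline S T' := by
  obtain ⟨shrink, long, notches, ⟨l, hl, hTl⟩, h1, h2, h3⟩ := h
  obtain ⟨φ, a1, a2, a3⟩ := hT
  obtain ⟨ψ, b1⟩ : ∃ ψ : Line → Line, ∀ a ∈ T.edges, ψ (φ a) = a := by
    have : Nonempty Line := ⟨⟨true, 0⟩⟩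
    have hinj : Set.InjOn φ {a | a ∈ T.edges} := by
      intro a ha b hb hab
      have hv : a.vert = b.vert := by rw [← a1 a ha, ← a1 b hb, hab]
      rcases lt_trichotomy a.pos b.pos with h | h | h
      · exact absurd (congrArg Line.pos hab) (a2 a ha b hb hv h).ne
      · exact Line.ext hv h
      · exact absurd (congrArg Line.pos hab) (a2 b hb a ha hv.symm h).ne'
    exact ⟨Function.invFunOn φ {a | a ∈ T.edges}, fun a ha => hinj.leftInvOn_invFunOn ha⟩
  have hlt : ∀ a ∈ T.edges, ∀ b ∈ T.edges, a.vert = b.vert → (φ a).pos < (φ b).pos →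
      a.pos < b.pos := by
    intro a ha b hb hv hab
    rcases lt_trichotomy a.pos b.pos with h | h | h
    · exact h
    · rw [Line.ext hv h] at hab; exact absurd hab (lt_irrefl _)
    · exact absurd (a2 b hb a ha hv.symm h) hab.asymm
  have hmem : ∀ e ∈ S.edges, ∀ a ∈ notchedEdge (long e) (notches e), a ∈ T.edges := by
    intro e he a ha
    rw [hl] at he
    rw [hTl]
    exact Cycle.mem_coe_iff.2 (List.mem_flatMap.2 ⟨e, Cycle.mem_coe_iff.1 he, ha⟩)
  have hpw : ∀ (u v : Line) (L : List Line), (∀ a ∈ L, a ∈ T.edges) →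
      (∀ a ∈ L, ∀ b ∈ L, a.vert = b.vert) → L.Pairwise (SameDirection u v) →
      (L.map φ).Pairwise (SameDirection u v) := by
    intro u v L hL hv hp
    refine List.pairwise_map.2 (hp.imp_of_mem fun {a b} ha hb hab => hab.map ?_ ?_)
    · exact a2 a (hL a ha) b (hL b hb) (hv a ha b hb)
    · exact a2 b (hL b hb) a (hL a ha) (hv b hb a ha)
  refine ⟨shrink ∘ ψ, φ ∘ long, fun e => (notches e).map (Prod.map φ φ), ⟨l, hl, ?_⟩, ?_, ?_, ?_⟩
  · rw [← a3, hTl]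
    exact congrArg (fun l : List Line => (l : Cycle Line))
      (map_flatMap_notchedEdge φ long notches l)
  · intro b hb
    rw [← a3] at hb
    obtain ⟨a, ha, rfl⟩ := mem_map_cycle.1 hb
    rw [Function.comp_apply, b1 a ha, h1 a ha, a1 a ha]
  · intro b hb c hc hv hlt
    rw [← a3] at hb hc
    obtain ⟨a, ha, rfl⟩ := mem_map_cycle.1 hb
    obtain ⟨d, hd, rfl⟩ := mem_map_cycle.1 hc
    simp only [Function.comp_apply, b1 a ha, b1 d hd] at hlt
    rw [a1 a ha, a1 d hd] at hv
    exact a2 a ha d hd hv (h2 a ha d hd hv hlt)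
  · intro c d e g hs
    obtain ⟨c1, c2, c3, c4⟩ := h3 c d e g hs
    have he : e ∈ S.edges := successive_mem hs (by simp)
    have hg : g ∈ S.edges := successive_mem hs (by simp)
    have ml : long e ∈ T.edges := hmem e he _ (mem_notchedEdge.2 (.inl rfl))
    have mg : long g ∈ T.edges := hmem g hg _ (mem_notchedEdge.2 (.inl rfl))
    have m1 : ∀ z ∈ notches e, z.1 ∈ T.edges := fun z hz =>
      hmem e he _ (mem_notchedEdge.2 (.inr ⟨z, hz, .inl rfl⟩))
    have m2 : ∀ z ∈ notches e, z.2 ∈ T.edges := fun z hz =>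
      hmem e he _ (mem_notchedEdge.2 (.inr ⟨z, hz, .inr rfl⟩))
    have sg : shrink (long g) = g := by
      obtain ⟨c', d', g', hs'⟩ := exists_successive S hg
      exact (h3 _ _ _ _ hs').1
    refine ⟨?_, ?_, ?_, ?_⟩
    · simp only [Function.comp_apply]; rw [b1 _ ml, c1]
    · intro z hz'
      obtain ⟨z, hz, rfl⟩ := List.mem_map.1 hz'
      simp only [Function.comp_apply, Prod.map_fst, Prod.map_snd]
      rw [b1 _ (m1 z hz), b1 _ (m2 z hz)]
      exact c2 z hz
    · have := hpw c e (long e :: (notches e).map Prod.snd) ?_ ?_ c3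
      · simpa [List.map_map, Function.comp_def] using this
      · simp only [List.mem_cons, List.mem_map]
        rintro a (rfl | ⟨z, hz, rfl⟩)
        exacts [ml, m2 z hz]
      · have : ∀ a ∈ long e :: (notches e).map Prod.snd, a.vert = e.vert := by
          simp only [List.mem_cons, List.mem_map]
          rintro a (rfl | ⟨z, hz, rfl⟩)
          · rw [← h1 _ ml, c1]
          · rw [← h1 _ (m2 z hz), (c2 z hz).2]
        exact fun a ha b hb => (this a ha).trans (this b hb).symm
    · have := hpw d g ((notches e).map Prod.fst ++ [long g]) ?_ ?_ c4
      · simpa [List.map_map, Function.comp_def] using this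
      · simp only [List.mem_append, List.mem_singleton, List.mem_map]
        rintro a (⟨z, hz, rfl⟩ | rfl)
        exacts [m1 z hz, mg]
      · have : ∀ a ∈ (notches e).map Prod.fst ++ [long g], a.vert = g.vert := by
          simp only [List.mem_append, List.mem_singleton, List.mem_map]
          rintro a (⟨z, hz, rfl⟩ | rfl)
          · rw [← h1 _ (m1 z hz), (c2 z hz).1]
          · rw [← h1 _ mg, sg]
        exact fun a ha b hb => (this a ha).trans (this b hb).symm

/-- A line next to `y` compares with all the other lines as `y` does, so only its order relative to
`y` itself has to be checked. -/
theorem pairwise_insert_before {W : Finset Line} {u v n y : Line} {up : Bool} {A B : List Line}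
    (h : (A ++ y :: B).Pairwise (SameDirection u v)) (hW : ∀ a ∈ A ++ y :: B, a ∈ W)
    (hn : NextTo W Line.pos y.pos n.pos up) (hy : SameDirection u v n y) :
    (A ++ n :: y :: B).Pairwise (SameDirection u v) := by
  rw [List.pairwise_append, List.pairwise_cons] at h ⊢
  obtain ⟨h1, ⟨h2, h3⟩, h4⟩ := h
  have near := fun k hk => hn.near k (hW k hk)
  refine ⟨h1, ⟨?_, List.pairwise_cons.2 ⟨h2, h3⟩⟩, ?_⟩
  · intro b hb
    rcases List.mem_cons.1 hb with rfl | hb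
    · exact hy
    · have := near b (by simp [hb])
      exact (h2 b hb).map this.1 this.2
  · intro a ha b hb
    rcases List.mem_cons.1 hb with rfl | hb
    · have := near a (by simp [ha])
      exact (h4 a ha y (by simp)).map this.2 this.1
    · exact h4 a ha b hb

theorem pairwise_insert_after {W : Finset Line} {u v n x : Line} {up : Bool} {A B : List Line}
    (h : (A ++ x :: B).Pairwise (SameDirection u v)) (hW : ∀ a ∈ A ++ x :: B, a ∈ W)
    (hn : NextTo W Line.pos x.pos n.pos up) (hx : SameDirection u v x n) :
    (A ++ x :: n :: B).Pairwise (SameDirection u v) := by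
  rw [List.pairwise_append, List.pairwise_cons] at h ⊢
  obtain ⟨h1, ⟨h2, h3⟩, h4⟩ := h
  have near := fun k hk => hn.near k (hW k hk)
  have hnB : ∀ b ∈ B, SameDirection u v n b := fun b hb => by
    have := near b (by simp [hb])
    exact (h2 b hb).map this.1 this.2
  refine ⟨h1, ⟨?_, List.pairwise_cons.2 ⟨hnB, h3⟩⟩, ?_⟩
  · intro b hb
    rcases List.mem_cons.1 hb with rfl | hb
    exacts [hx, h2 b hb]
  · intro a ha b hb
    rcases List.mem_cons.1 hb with rfl | hb
    · exact h4 a ha b (by simp)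
    rcases List.mem_cons.1 hb with rfl | hb
    · have := near a (by simp [ha])
      exact (h4 a ha x (by simp)).map this.2 this.1
    · exact h4 a ha b (by simp [hb])

theorem NextTo.sameDirection_before {W : Finset Line} {u v n y : Line}
    (huv : u.pos ≠ v.pos) (h : NextTo W Line.pos y.pos n.pos (decide (v.pos < u.pos))) :
    SameDirection u v n y := by
  rcases lt_or_gt_of_ne huv with hl | hl
  · exact .inl ⟨hl, h.gt (by simpa using hl.le)⟩
  · exact .inr ⟨hl, h.lt (by simpa using hl)⟩

theorem NextTo.sameDirection_after {W : Finset Line} {u v n x : Line}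
    (huv : u.pos ≠ v.pos) (h : NextTo W Line.pos x.pos n.pos (decide (u.pos < v.pos))) :
    SameDirection u v x n := by
  rcases lt_or_gt_of_ne huv with hl | hl
  · exact .inl ⟨hl, h.lt (by simpa using hl)⟩
  · exact .inr ⟨hl, h.gt (by simpa using hl.le)⟩

end RectDiagram

/-! ### Outlines of diagrams with an inserted pair, and conclusion -/

namespace RectDiagram

/-- Recognizing an outline after the insertion of two lines `n₁`, `n₂` at the corner formed by `x`
and `y`, in terms of the notches of the only edge `e` which is affected. -/
theorem isOutline_of_insert {S T U : RectDiagram} {shrink long : Line → Line}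
    {notches : Line → List (Line × Line)} {e g x n₁ n₂ y : Line} {m l : List Line}
    {new : List (Line × Line)} {up₁ up₂ : Bool}
    (hS : S.edges = ((e :: g :: m : List Line) : Cycle Line))
    (hT : T.edges = ((x :: y :: l : List Line) : Cycle Line))
    (hU : U.edges = ((x :: n₁ :: n₂ :: y :: l : List Line) : Cycle Line))
    (hUe : U.edges = ((notchedEdge (long e) new ++
      (g :: m).flatMap (fun e => notchedEdge (long e) (notches e)) : List Line) : Cycle Line))
    (hmem : ∀ e ∈ S.edges, ∀ a ∈ notchedEdge (long e) (notches e), a ∈ T.edges)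
    (h1 : ∀ a ∈ T.edges, (shrink a).vert = a.vert)
    (h2 : ∀ a ∈ T.edges, ∀ b ∈ T.edges, a.vert = b.vert →
      (shrink a).pos < (shrink b).pos → a.pos < b.pos)
    (h3 : ∀ c d e g : Line, Successive S.edges [c, d, e, g] →
      shrink (long e) = e ∧
      (∀ z ∈ notches e, shrink z.1 = g ∧ shrink z.2 = e) ∧
      (long e :: (notches e).map Prod.snd).Pairwise (SameDirection c e) ∧
      ((notches e).map Prod.fst ++ [long g]).Pairwise (SameDirection d g))
    (hv₁ : n₁.vert = y.vert) (hv₂ : n₂.vert = x.vert)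
    (hn₁ : NextTo T.edges.toFinset Line.pos y.pos n₁.pos up₁)
    (hn₂ : NextTo T.edges.toFinset Line.pos x.pos n₂.pos up₂)
    (hnew : ∀ z ∈ new, (z.1 ∈ T.edges ∧ shrink z.1 = g ∨ z.1 = n₁ ∧ shrink y = g ∨
        z.1 = n₂ ∧ shrink x = g) ∧
      (z.2 ∈ T.edges ∧ shrink z.2 = e ∨ z.2 = n₁ ∧ shrink y = e ∨ z.2 = n₂ ∧ shrink x = e))
    (hp : ∀ c d, Successive S.edges [c, d, e, g] →
      (long e :: new.map Prod.snd).Pairwise (SameDirection c e) ∧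
      (new.map Prod.fst ++ [long g]).Pairwise (SameDirection d g)) : IsOutline S U := by
  have hx : x ∈ T.edges := by rw [hT]; simp
  have hy : y ∈ T.edges := by rw [hT]; simp
  have hxy : x.vert ≠ y.vert := by
    have := T.alternating
    rw [hT] at this
    simp only [Cycle.chain_coe_cons, List.cons_append, List.isChain_cons_cons] at this
    exact this.1
  have n12 : n₁ ≠ n₂ := fun h => hxy (by rw [← hv₁, ← hv₂, h])
  have t1 : ∀ a ∈ T.edges, a ≠ n₁ := fun a ha h => hn₁.apply_ne (mem_toFinset.2 ha) (by rw [h])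
  have t2 : ∀ a ∈ T.edges, a ≠ n₂ := fun a ha h => hn₂.apply_ne (mem_toFinset.2 ha) (by rw [h])
  have mU : ∀ a ∈ U.edges, a = n₁ ∨ a = n₂ ∨ a ∈ T.edges := by
    intro a ha
    rw [hU] at ha
    rw [hT]
    simp only [Cycle.mem_coe_iff, List.mem_cons] at ha ⊢
    tauto
  -- Shrinking sends each inserted line to the image of the line it was placed next to.
  set σ : Line → Line := fun a => if a = n₁ then shrink y else if a = n₂ then shrink x else shrink a
    with hσ
  have σ1 : σ n₁ = shrink y := by simp [hσ]
  have σ2 : σ n₂ = shrink x := by simp [hσ, n12.symm]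
  have σT : ∀ a ∈ T.edges, σ a = shrink a := fun a ha => by simp [hσ, t1 a ha, t2 a ha]
  have hnodup : (e :: g :: m).Nodup := by
    have := S.nodup; rwa [hS, Cycle.nodup_coe_iff] at this
  have near : ∀ {n y : Line} {up : Bool}, y ∈ T.edges → n.vert = y.vert →
      NextTo T.edges.toFinset Line.pos y.pos n.pos up → ∀ a ∈ T.edges, a.vert = n.vert →
      ((shrink a).pos < (shrink y).pos → a.pos < n.pos) ∧
      ((shrink y).pos < (shrink a).pos → n.pos < a.pos) := by
    intro n y up hy hv hn a ha hav
    have := hn.near a (mem_toFinset.2 ha)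
    exact ⟨fun h => this.2 (h2 a ha y hy (hav.trans hv) h),
      fun h => this.1 (h2 y hy a ha (hav.trans hv).symm h)⟩
  have near₁ := near hy hv₁ hn₁
  have near₂ := near hx hv₂ hn₂
  refine ⟨σ, long, Function.update notches e new, ⟨e :: g :: m, hS, ?_⟩, ?_, ?_, ?_⟩
  · refine hUe.trans (congrArg (fun l : List Line => (l : Cycle Line)) ?_)
    rw [List.flatMap_cons (x := e), Function.update_self, List.append_cancel_left_eq]
    refine List.flatMap_congr fun a ha => ?_
    rw [Function.update_of_ne]
    rintro rfl
    exact (List.nodup_cons.1 hnodup).1 ha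
  · intro a ha
    rcases mU a ha with rfl | rfl | ha
    · rw [σ1, h1 y hy, hv₁]
    · rw [σ2, h1 x hx, hv₂]
    · rw [σT a ha, h1 a ha]
  · intro a ha b hb hab hlt
    rcases mU a ha with rfl | rfl | ha <;> rcases mU b hb with rfl | rfl | hb
    · exact absurd hlt (lt_irrefl _)
    · exact absurd (hv₂.symm.trans (hab.symm.trans hv₁)) hxy
    · rw [σ1, σT b hb] at hlt
      exact (near₁ b hb hab.symm).2 hlt
    · exact absurd (hv₂.symm.trans (hab.trans hv₁)) hxy
    · exact absurd hlt (lt_irrefl _)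
    · rw [σ2, σT b hb] at hlt
      exact (near₂ b hb hab.symm).2 hlt
    · rw [σ1, σT a ha] at hlt
      exact (near₁ a ha hab).1 hlt
    · rw [σ2, σT a ha] at hlt
      exact (near₂ a ha hab).1 hlt
    · rw [σT a ha, σT b hb] at hlt
      exact h2 a ha b hb hab hlt
  · intro c d e' g' hs
    obtain ⟨c1, c2, c3, c4⟩ := h3 c d e' g' hs
    have he' : e' ∈ S.edges := successive_mem hs (by simp)
    have ml : long e' ∈ T.edges := hmem e' he' _ (mem_notchedEdge.2 (.inl rfl))
    refine ⟨by rw [σT _ ml, c1], ?_⟩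
    by_cases hee : e' = e
    · subst hee
      obtain rfl : g' = g := by
        have hg : ∃ d0, Successive S.edges [d0, e', g] := by
          have : m ≠ [] := by
            rintro rfl
            have := S.four_le_length
            rw [hS] at this; simp at this
          refine ⟨m.getLast this, m.dropLast, ?_⟩
          rw [hS]
          conv_lhs => rw [← List.dropLast_append_getLast this]
          exact coe_append_comm (e' :: g :: m.dropLast) [m.getLast this]
        obtain ⟨d0, hd0⟩ := hg
        exact (successive_unique S.nodup (successive_right hs) hd0).2
      rw [Function.update_self]
      refine ⟨fun z hz => ?_, hp c d hs⟩
      obtain ⟨z1, z2⟩ := hnew z hz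
      constructor
      · rcases z1 with ⟨h, h'⟩ | ⟨h, h'⟩ | ⟨h, h'⟩
        · rw [σT _ h, h']
        · rw [h, σ1, h']
        · rw [h, σ2, h']
      · rcases z2 with ⟨h, h'⟩ | ⟨h, h'⟩ | ⟨h, h'⟩
        · rw [σT _ h, h']
        · rw [h, σ1, h']
        · rw [h, σ2, h']
    · rw [Function.update_of_ne hee]
      refine ⟨fun z hz => ?_, c3, c4⟩
      rw [σT _ (hmem e' he' _ (mem_notchedEdge.2 (.inr ⟨z, hz, .inl rfl⟩))),
        σT _ (hmem e' he' _ (mem_notchedEdge.2 (.inr ⟨z, hz, .inr rfl⟩)))]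
      exact c2 z hz

/-- The corner is given in one cutting of the cyclic sequence and needed in another, the one adapted
to notched edges. -/
theorem insert_at_corner {T : RectDiagram} {x y y' : Line} {l P Q : List Line}
    (hT : T.edges = ((x :: y :: l : List Line) : Cycle Line))
    (hT' : T.edges = ((P ++ x :: y' :: Q : List Line) : Cycle Line)) :
    y' = y ∧ ∀ n₁ n₂ : Line, ((x :: n₁ :: n₂ :: y :: l : List Line) : Cycle Line) =
      ((P ++ x :: n₁ :: n₂ :: y :: Q : List Line) : Cycle Line) := by
  have hn := T.nodup
  rw [hT, Cycle.nodup_coe_iff] at hn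
  have h := hT.symm.trans (hT'.trans (coe_append_comm P (x :: y' :: Q)))
  obtain ⟨rfl, rfl⟩ := List.cons.inj
    (eq_of_isRotated_cons (v := y' :: (Q ++ P)) hn (Cycle.coe_eq_coe.1 h))
  exact ⟨rfl, fun n₁ n₂ => (coe_append_comm P (x :: n₁ :: n₂ :: y :: Q)).symm⟩

/-- The outline of a diagram persists when two lines are inserted at a corner on suitable sides. -/
theorem IsOutline.exists_sides {S T : RectDiagram} (h : IsOutline S T) {x y : Line}
    {l : List Line} (hT : T.edges = ((x :: y :: l : List Line) : Cycle Line)) :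
    ∃ up₁ up₂ : Bool, ∀ (n₁ n₂ : Line) (U : RectDiagram),
      U.edges = ((x :: n₁ :: n₂ :: y :: l : List Line) : Cycle Line) →
      n₁.vert = y.vert → n₂.vert = x.vert →
      NextTo T.edges.toFinset Line.pos y.pos n₁.pos up₁ →
      NextTo T.edges.toFinset Line.pos x.pos n₂.pos up₂ → IsOutline S U := by
  obtain ⟨shrink, long, notches, ⟨l₀, hl, hTl⟩, h1, h2, h3⟩ := h
  have hmem : ∀ e ∈ S.edges, ∀ a ∈ notchedEdge (long e) (notches e), a ∈ T.edges := by
    intro e he a ha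
    rw [hl] at he
    rw [hTl]
    exact Cycle.mem_coe_iff.2 (List.mem_flatMap.2 ⟨e, Cycle.mem_coe_iff.1 he, ha⟩)
  have hx : x ∈ T.edges := by rw [hT]; simp
  rw [hTl, Cycle.mem_coe_iff, List.mem_flatMap] at hx
  obtain ⟨e, he, hxe⟩ := hx
  obtain ⟨A₀, B₀, rfl⟩ := List.append_of_mem he
  have heS : e ∈ S.edges := by rw [hl]; exact he
  obtain ⟨c, d, g, hs⟩ := exists_successive S heS
  obtain ⟨m, hm⟩ : ∃ m, B₀ ++ A₀ = g :: m := by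
    obtain ⟨m, hm⟩ := successive_right hs
    refine ⟨m ++ [d], ?_⟩
    have hn := S.nodup
    rw [hl, coe_append_comm, Cycle.nodup_coe_iff] at hn
    refine eq_of_isRotated_cons hn (Cycle.coe_eq_coe.1 ?_)
    exact (coe_append_comm A₀ (e :: B₀)).symm.trans
      (hl.symm.trans (hm.trans (coe_append_comm [d] (e :: g :: m))))
  have hS : S.edges = ((e :: g :: m : List Line) : Cycle Line) := by
    rw [hl, coe_append_comm, List.cons_append, hm]
  have hTe : T.edges = ((notchedEdge (long e) (notches e) ++
      (g :: m).flatMap (fun e => notchedEdge (long e) (notches e)) : List Line) : Cycle Line) := by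
    rw [hTl, List.flatMap_append, coe_append_comm, ← List.flatMap_append, List.cons_append, hm]
    rfl
  obtain ⟨c1, c2, c3, c4⟩ := h3 c d e g hs
  have hg : g ∈ S.edges := successive_mem hs (by simp)
  have sg : shrink (long g) = g := by
    obtain ⟨c', d', g', hs'⟩ := exists_successive S hg
    exact (h3 _ _ _ _ hs').1
  have hp1 := (successive_left hs).perp
  have hp2 := (successive_right hs).perp
  have hne : c.pos ≠ e.pos ∧ d.pos ≠ g.pos := by
    obtain ⟨k, hk⟩ := hs
    have hn := S.nodup
    rw [hk, Cycle.nodup_coe_iff] at hn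
    simp only [List.cons_append, List.nodup_cons, List.mem_cons, not_or] at hn
    exact ⟨fun h => hn.1.2.1 (Line.ext (vert_eq_of_ne hp1.2.2.1 hp1.2.2.2) h),
      fun h => hn.2.1.2.1 (Line.ext (vert_eq_of_ne hp2.2.2.1 hp2.2.2.2) h)⟩
  have uniq : ∀ c' d', Successive S.edges [c', d', e, g] → c' = c ∧ d' = d := by
    intro c' d' hs'
    obtain ⟨rfl, -⟩ := successive_unique S.nodup (successive_right hs') (successive_right hs)
    exact ⟨(successive_unique S.nodup (successive_left hs') (successive_left hs)).1, rfl⟩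
  have mfst : ∀ a ∈ (notches e).map Prod.fst ++ [long g], a ∈ T.edges.toFinset := by
    simp only [List.mem_append, List.mem_singleton, List.mem_map]
    rintro a (⟨z, hz, rfl⟩ | rfl)
    · exact mem_toFinset.2 (hmem e heS _ (mem_notchedEdge.2 (.inr ⟨z, hz, .inl rfl⟩)))
    · exact mem_toFinset.2 (hmem g hg _ (mem_notchedEdge.2 (.inl rfl)))
  have msnd : ∀ a ∈ long e :: (notches e).map Prod.snd, a ∈ T.edges.toFinset := by
    simp only [List.mem_cons, List.mem_map]
    rintro a (rfl | ⟨z, hz, rfl⟩)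
    · exact mem_toFinset.2 (hmem e heS _ (mem_notchedEdge.2 (.inl rfl)))
    · exact mem_toFinset.2 (hmem e heS _ (mem_notchedEdge.2 (.inr ⟨z, hz, .inr rfl⟩)))
  have hz : ∀ z ∈ notches e, (z.1 ∈ T.edges ∧ shrink z.1 = g) ∧ z.2 ∈ T.edges ∧ shrink z.2 = e :=
    fun z hz => ⟨⟨hmem e heS _ (mem_notchedEdge.2 (.inr ⟨z, hz, .inl rfl⟩)), (c2 z hz).1⟩,
      hmem e heS _ (mem_notchedEdge.2 (.inr ⟨z, hz, .inr rfl⟩)), (c2 z hz).2⟩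
  -- If `x` is the first short edge of a notch, then `y` is the second one, `z₂`. The notch splits
  -- into `(x, n₁)` and `(n₂, z₂)`: `n₁` has to come just before `y` in the direction from `c` to
  -- `e`, and `n₂` just after `x` in the direction from `d` to `g`.
  by_cases hfst : ∃ z ∈ notches e, x = z.1
  · obtain ⟨⟨z₁, z₂⟩, hzm, rfl⟩ := hfst
    obtain ⟨A, B, hAB⟩ := List.append_of_mem hzm
    obtain ⟨rfl, hins⟩ := insert_at_corner (y' := z₂)
      (P := long e :: A.flatMap (fun z => [z.1, z.2]))
      (Q := B.flatMap (fun z => [z.1, z.2]) ++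
        (g :: m).flatMap (fun e => notchedEdge (long e) (notches e))) hT
      (by rw [hTe, hAB]; simp [notchedEdge])
    refine ⟨decide (e.pos < c.pos), decide (d.pos < g.pos), fun n₁ n₂ U hU hv₁ hv₂ hn₁ hn₂ => ?_⟩
    refine isOutline_of_insert (new := A ++ (x, n₁) :: (n₂, z₂) :: B) hS hT hU ?_ hmem h1 h2 h3
      hv₁ hv₂ hn₁ hn₂ ?_ ?_
    · rw [hU, hins n₁ n₂]; simp [notchedEdge]
    · rw [hAB] at hz
      intro z hz'
      simp only [List.mem_append, List.mem_cons] at hz hz'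
      have hz₀ := hz (x, z₂) (by simp)
      simp only at hz₀
      rcases hz' with h | rfl | rfl | h
      · have := hz z (by simp [h]); tauto
      · tauto
      · tauto
      · have := hz z (by simp [h]); tauto
    · intro c' d' hs'
      obtain ⟨rfl, rfl⟩ := uniq c' d' hs'
      rw [hAB] at c3 c4 mfst msnd
      simp only [List.map_append, List.map_cons, List.append_assoc, List.cons_append] at c3 c4 mfst msnd ⊢
      refine ⟨?_, ?_⟩
      · exact pairwise_insert_before (A := long e :: A.map Prod.snd) c3 msnd hn₁
          (hn₁.sameDirection_before hne.1)
      · exact pairwise_insert_after c4 mfst hn₂ (hn₂.sameDirection_after hne.2)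
  -- Otherwise `x` is the long edge or the second short edge of a notch, and `y` is the first edge
  -- of the next notch or `long g`. Now `(n₁, n₂)` is itself a new notch: `n₂` has to follow `x` in
  -- the direction from `c` to `e`, and `n₁` to precede `y` in that from `d` to `g`.
  · obtain ⟨A, B, hAB, P, hP, L, hL⟩ : ∃ A B, notches e = A ++ B ∧
        ∃ P, long e :: A.flatMap (fun z => [z.1, z.2]) = P ++ [x] ∧
        ∃ L, long e :: A.map Prod.snd = L ++ [x] := by
      rcases mem_notchedEdge.1 hxe with rfl | ⟨z, hzm, h | rfl⟩
      · exact ⟨[], notches e, rfl, [], rfl, [], rfl⟩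
      · exact absurd ⟨z, hzm, h⟩ hfst
      · obtain ⟨A, B, hAB⟩ := List.append_of_mem hzm
        exact ⟨A ++ [z], B, by simp [hAB], long e :: (A.flatMap (fun z => [z.1, z.2]) ++ [z.1]),
          by simp, long e :: A.map Prod.snd, by simp⟩
    obtain ⟨y', Q, hQ, L', hL', hsy⟩ : ∃ y' Q, B.flatMap (fun z => [z.1, z.2]) ++
        (g :: m).flatMap (fun e => notchedEdge (long e) (notches e)) = y' :: Q ∧
        ∃ L', B.map Prod.fst ++ [long g] = y' :: L' ∧ shrink y' = g := by
      match B, hAB with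
      | [], _ => exact ⟨long g, _, rfl, [], rfl, sg⟩
      | z :: B, hAB => exact ⟨z.1, _, rfl, B.map Prod.fst ++ [long g], rfl,
          (c2 z (by rw [hAB]; simp)).1⟩
    have hsx : shrink x = e := by
      rcases mem_notchedEdge.1 hxe with rfl | ⟨z, hzm, h | rfl⟩
      · exact c1
      · exact absurd ⟨z, hzm, h⟩ hfst
      · exact (c2 z hzm).2
    have hsplit : ∀ n : List (Line × Line), notchedEdge (long e) (A ++ n ++ B) ++
        (g :: m).flatMap (fun e => notchedEdge (long e) (notches e)) =
        P ++ x :: (n.flatMap (fun z => [z.1, z.2]) ++ y' :: Q) := by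
      intro n
      rw [notchedEdge, List.flatMap_append, List.flatMap_append, List.append_assoc,
        ← List.cons_append, hP, ← hQ]
      simp
    obtain ⟨rfl, hins⟩ := insert_at_corner (y' := y') (P := P) (Q := Q) hT
      (by rw [hTe, hAB]; exact congrArg (fun l : List Line => (l : Cycle Line))
            (by simpa using hsplit []))
    refine ⟨decide (g.pos < d.pos), decide (c.pos < e.pos), fun n₁ n₂ U hU hv₁ hv₂ hn₁ hn₂ => ?_⟩
    refine isOutline_of_insert (new := A ++ [(n₁, n₂)] ++ B) hS hT hU ?_ hmem h1 h2 h3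
      hv₁ hv₂ hn₁ hn₂ ?_ ?_
    · rw [hU, hins n₁ n₂, hsplit]; simp
    · rw [hAB] at hz
      intro z hz'
      simp only [List.mem_append, List.mem_cons, List.not_mem_nil, or_false] at hz hz'
      rcases hz' with (h | rfl) | h
      · have := hz z (.inl h); tauto
      · tauto
      · have := hz z (.inr h); tauto
    · intro c' d' hs'
      obtain ⟨rfl, rfl⟩ := uniq c' d' hs'
      rw [hAB] at c3 c4 mfst msnd
      simp only [List.map_append, List.map_cons, List.append_assoc, List.cons_append,
        List.nil_append] at c3 c4 mfst msnd ⊢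
      rw [hL'] at c4 mfst ⊢
      rw [← List.cons_append, hL, List.append_assoc] at c3 msnd ⊢
      exact ⟨pairwise_insert_after c3 msnd hn₂ (hn₂.sameDirection_after hne.1),
        pairwise_insert_before c4 mfst hn₁ (hn₁.sameDirection_before hne.2)⟩

/-- After an insertion into a diagram with outline `S`, exchange moves produce a diagram with
outline `S` again. -/
theorem IsOutline.exists_of_inserted {S T U : RectDiagram} (h : IsOutline S T)
    (hU : Inserted T U) : ∃ U', Equi U U' ∧ IsOutline S U' := by
  obtain ⟨x, y, l, hT, H⟩ := hU.exists_sides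
  obtain ⟨up₁, up₂, H'⟩ := h.exists_sides hT
  obtain ⟨n₁, n₂, U', e, h1, h2, h3, h4, h5⟩ := H up₁ up₂
  exact ⟨U', e, H' n₁ n₂ U' h1 h2 h3 h4 h5⟩

/-- If a move leads from `S` to `S'`, then an outline of a diagram equivalent to `S'` is an
outline of a diagram equivalent to `S`. -/
theorem exists_equi_of_move {S S' R : RectDiagram} (h : Merge S S' ∨ Exchange S S')
    (h' : ∃ T, Equi S' T ∧ IsOutline R T) : ∃ T, Equi S T ∧ IsOutline R T := by
  obtain ⟨T, hT, hR⟩ := h'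
  rcases h with h | h
  · obtain ⟨U, hU, hI⟩ := h.exists_inserted
    obtain ⟨U₁, hU₁, hI₁⟩ := hI.lift hT
    obtain ⟨U₂, hU₂, hR₂⟩ := hR.exists_of_inserted hI₁
    exact ⟨U₂, (hU.trans hU₁).trans hU₂, hR₂⟩
  · exact ⟨T, hT.head (.inl h), hR⟩

theorem exists_equi_outline {m : ℕ} {S : ℕ → RectDiagram}
    (hS : ∀ i < m, Merge (S i) (S (i + 1)) ∨ Exchange (S i) (S (i + 1))) {i : ℕ} (hi : i ≤ m) :
    ∃ T, Equi (S 0) T ∧ IsOutline (S i) T := by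
  -- The induction runs backwards from `S i`: undoing a merge inserts a pair into the diagram
  -- already built for the later part of the sequence.
  have key : ∀ k ≤ i, ∃ T, Equi (S (i - k)) T ∧ IsOutline (S i) T := by
    intro k
    induction k with
    | zero => exact fun _ => ⟨S i, .refl, isOutline_refl _⟩
    | succ k ih =>
      intro hk
      have h := hS (i - (k + 1)) (by omega)
      have e : i - (k + 1) + 1 = i - k := by omega
      rw [e] at h
      exact exists_equi_of_move h (ih (by omega))
  simpa using key i le_rfl

end RectDiagram

theorem mainTheorem3 (m : ℕ) (S : ℕ → RectDiagram)
    (hS : ∀ i < m, RectDiagram.Merge (S i) (S (i + 1)) ∨ RectDiagram.Exchange (S i) (S (i + 1))) :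
    ∃ T : ℕ → RectDiagram, T 0 = S 0 ∧
      (∀ i ≤ m, RectDiagram.IsOutline (S i) (T i)) ∧
      (∀ i < m, Relation.ReflTransGen RectDiagram.Exchange (T i) (T (i + 1))) := by
  -- The equivalence of each `T i` with `S 0` is carried along, because consecutive diagrams are
  -- connected through `S 0`.
  have key : ∀ k ≤ m, ∃ T : ℕ → RectDiagram, T 0 = S 0 ∧
      (∀ i ≤ k, RectDiagram.IsOutline (S i) (T i) ∧ RectDiagram.Equi (S 0) (T i)) ∧
      (∀ i < k, Relation.ReflTransGen RectDiagram.Exchange (T i) (T (i + 1))) := by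
    intro k
    induction k with
    | zero =>
      refine fun _ => ⟨S, rfl, fun i hi => ?_, fun i hi => absurd hi (Nat.not_lt_zero i)⟩
      rw [Nat.le_zero.1 hi]
      exact ⟨RectDiagram.isOutline_refl _, .refl⟩
    | succ k ih =>
      intro hk
      obtain ⟨T, h0, h1, h2⟩ := ih (by omega)
      obtain ⟨V, hV, hO⟩ := RectDiagram.exists_equi_outline hS hk
      have hTV : RectDiagram.Equi (T k) V := (h1 k le_rfl).2.symm.trans hV
      -- Replacing `V` by an isotopic `V'` leaves exchange moves only, and having `S (k + 1)` as an
      -- outline is invariant under isotopy.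
      obtain ⟨V', hV', hiso⟩ := hTV.exists_exchanges
      refine ⟨Function.update T (k + 1) V', ?_, fun i hi => ?_, fun i hi => ?_⟩
      · rw [Function.update_of_ne (by omega), h0]
      · rcases Nat.le_succ_iff.1 hi with hi | rfl
        · rw [Function.update_of_ne (by omega)]
          exact h1 i hi
        · rw [Function.update_self]
          exact ⟨hO.of_sameUpToIsotopy hiso, hV.tail (.inr hiso)⟩
      · rw [Function.update_of_ne (by omega : i ≠ k + 1)]
        rcases Nat.lt_succ_iff_lt_or_eq.1 hi with hi | rfl
        · rw [Function.update_of_ne (by omega)]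
          exact h2 i hi
        · rw [Function.update_self]
          exact hV'
  obtain ⟨T, h0, h1, h2⟩ := key m le_rfl
  exact ⟨T, h0, fun i hi => (h1 i hi).1, h2⟩
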